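/- **Definitions.** Let $A$ be a C*-algebra. A *presentation* of $A$ is a sequence $(v_n)_{n\in\mathbb N}$ in $A$ that generates a dense $*$-subalgebra. Its *rational vectors* are the elements $p(v_0,v_1,\dots)$, where $p$ is a rational $*$-polynomial, i.e. an element of the free non-unital $*$-algebra over $\mathbb{Q}(i)$ on $x_0,x_1,\dots$. The presentation is *computable* if there is an algorithm that, given (a code of) a rational $*$-polynomial $p$ and $k\in\mathbb N$, computes a rational $q$ with $\bigl|q-\|p(v_0,v_1,\dots)\|\bigr|<2^{-k}$; $A$ is *computably presentable* if it has a computable presentation. A *computable presentation* of a Polish space $X$ is a compatible complete metric $d$ together with a dense sequence $(p_n)_{n\in\mathbb N}$ in $X$ such that some algorithm, given $m,n,k$, computes a rational $q$ with $|q-d(p_m,p_n)|<2^{-k}$. It is *computably compact* if there is an algorithm that, given $k\in\mathbb N$, computes finitely many indices $n_0,\dots,n_t$ with $X=\bigcup_j B(p_{n_j};2^{-k})$. **Theorem.** Let $X$ be a nonempty compact metrizable space, and let $C^*(X)=C(X;\mathbb{C})$ be the C*-algebra of continuous complex functions on $X$. 1. If $C^*(X)$ is computably presentable, then $X$ has a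 computably compact presentation. 2. (Converse, due to A. Fox.) If $X$ has a computably compact presentation, then $C^*(X)$ is computably presentable. 3. (Classification.) Consequently, a nonzero commutative unital C*-algebra $A$ is computably presentable if and only if its spectrum $\Delta(A)$ (the nonzero homomorphisms $A\to\mathbb{C}$, with the topology of pointwise convergence) has a computably compact presentation. -/

import Mathlib

namespace ComputableGelfand

/-- A code `(a, b, c)` for the rational number `(a - b) / (c + 1)`; every rational number has a
code. -/
abbrev RatCode : Type := ℕ × ℕ × ℕ

/-- The rational number with a given code. -/
def RatCode.val (q : RatCode) : ℚ := ((q.1 : ℚ) - (q.2.1 : ℚ)) / ((q.2.2 : ℚ) + 1)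

/-- A code for an element of `ℚ(i)`: codes of the real and of the imaginary part. -/
abbrev GaussCode : Type := RatCode × RatCode

/-- The complex number with a given code. -/
def GaussCode.val (c : GaussCode) : ℂ := ⟨(c.1.val : ℝ), (c.2.val : ℝ)⟩

/-- A letter of the alphabet `x₀, x₀*, x₁, x₁*, …`: `(n, false)` is `xₙ` and `(n, true)` is
`xₙ*`. -/
abbrev Letter : Type := ℕ × Bool

/-- A monomial of the free (non-unital) `*`-algebra on `x₀, x₁, …` over `ℚ(i)`: a coefficient and
a nonempty word, given by its first letter and the list of the remaining letters. -/
abbrev RatMonomial : Type := GaussCode × Letter × List Letter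

/-- A rational `*`-polynomial, i.e. an element of the free (non-unital) `*`-algebra on
`x₀, x₁, …` over `ℚ(i)`, written as a formal sum of monomials. -/
abbrev RatStarPoly : Type := List RatMonomial

section CStar

variable {A : Type*} [NonUnitalCStarAlgebra A]

/-- The value of a letter under the substitution `xₙ ↦ v n`. -/
def Letter.eval (v : ℕ → A) (l : Letter) : A := bif l.2 then star (v l.1) else v l.1

/-- The value of a monomial under the substitution `xₙ ↦ v n`. -/
noncomputable def RatMonomial.eval (v : ℕ → A) (m : RatMonomial) : A :=
  GaussCode.val m.1 • m.2.2.foldl (fun a l => a * Letter.eval v l) (Letter.eval v m.2.1)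

/-- The value of a rational `*`-polynomial under the substitution `xₙ ↦ v n`. -/
noncomputable def RatStarPoly.eval (v : ℕ → A) (p : RatStarPoly) : A :=
  (p.map (RatMonomial.eval v)).sum

end CStar

/-- A presentation of a C*-algebra `A`: a sequence that generates a dense `*`-subalgebra
(the unit, if there is one, is not added to the generators). -/
structure CStarPresentation (A : Type*) [NonUnitalCStarAlgebra A] where
  vec : ℕ → A
  dense_adjoin : Dense (NonUnitalStarAlgebra.adjoin ℂ (Set.range vec) : Set A)

/-- A presentation is computable if the norm is computable on the rational vectors: there is an
algorithm which, given a rational `*`-polynomial `p` and `k : ℕ`, outputs a rational number that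
is within `2 ^ (-k)` of the norm of the rational vector given by `p`. -/
def CStarPresentation.IsComputable {A : Type*} [NonUnitalCStarAlgebra A]
    (P : CStarPresentation A) : Prop :=
  ∃ f : RatStarPoly × ℕ → RatCode, Computable f ∧
    ∀ (p : RatStarPoly) (k : ℕ),
      |((f (p, k)).val : ℝ) - ‖RatStarPoly.eval P.vec p‖| < (1 / 2 : ℝ) ^ k

/-- A C*-algebra is computably presentable if it has a computable presentation. -/
def ComputablyPresentable (A : Type*) [NonUnitalCStarAlgebra A] : Prop :=
  ∃ P : CStarPresentation A, P.IsComputable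

/-- A computable presentation of a (Polish) topological space `X`: a compatible complete metric
and a dense sequence of points whose mutual distances are uniformly computable. -/
structure ComputableSpacePresentation (X : Type*) [t : TopologicalSpace X] where
  metric : MetricSpace X
  compatible : metric.toPseudoMetricSpace.toUniformSpace.toTopologicalSpace = t
  complete : @CompleteSpace X metric.toPseudoMetricSpace.toUniformSpace
  point : ℕ → X
  dense_point : DenseRange point
  dist_computable : ∃ f : ℕ × ℕ × ℕ → RatCode, Computable f ∧
    ∀ m n k : ℕ, |((f (m, n, k)).val : ℝ) - metric.dist (point m) (point n)| < (1 / 2 : ℝ) ^ k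

/-- A computable presentation is computably compact if from `k` one can compute finitely many
indices such that the open balls of radius `2 ^ (-k)` about the corresponding points of the dense
sequence cover the space. -/
def ComputableSpacePresentation.IsComputablyCompact {X : Type*} [TopologicalSpace X]
    (P : ComputableSpacePresentation X) : Prop :=
  ∃ g : ℕ → List ℕ, Computable g ∧
    ∀ (k : ℕ) (x : X), ∃ n ∈ g k, P.metric.dist x (P.point n) < (1 / 2 : ℝ) ^ k

/-- The space `X` has a computably compact presentation. -/
def HasComputablyCompactPresentation (X : Type*) [TopologicalSpace X] : Prop :=
  ∃ P : ComputableSpacePresentation X, P.IsComputablyCompact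

end ComputableGelfand

namespace ComputableGelfand

section Computability

attribute [fun_prop] Computable

variable {α β γ σ : Type*} [Primcodable α] [Primcodable β] [Primcodable γ] [Primcodable σ]

@[fun_prop]
theorem computable_id' : Computable fun a : α => a := Computable.id

@[fun_prop]
theorem computable_const' (s : σ) : Computable fun _ : α => s := Computable.const s

@[fun_prop]
theorem computable_comp' {f : β → σ} {g : α → β} (hf : Computable f) (hg : Computable g) :
    Computable fun a => f (g a) := hf.comp hg

@[fun_prop]
theorem computable_pair {f : α → β} {g : α → γ} (hf : Computable f) (hg : Computable g) :
    Computable fun a => (f a, g a) := hf.pair hg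

@[fun_prop]
theorem computable_fst {f : α → β × γ} (hf : Computable f) : Computable fun a => (f a).1 :=
  Computable.fst.comp hf

@[fun_prop]
theorem computable_snd {f : α → β × γ} (hf : Computable f) : Computable fun a => (f a).2 :=
  Computable.snd.comp hf

@[fun_prop]
theorem computable_add {f g : α → ℕ} (hf : Computable f) (hg : Computable g) :
    Computable fun a => f a + g a := Primrec.nat_add.to_comp.comp hf hg

@[fun_prop]
theorem computable_mul {f g : α → ℕ} (hf : Computable f) (hg : Computable g) :
    Computable fun a => f a * g a := Primrec.nat_mul.to_comp.comp hf hg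

@[fun_prop]
theorem computable_sub {f g : α → ℕ} (hf : Computable f) (hg : Computable g) :
    Computable fun a => f a - g a := Primrec.nat_sub.to_comp.comp hf hg

@[fun_prop]
theorem computable_div {f g : α → ℕ} (hf : Computable f) (hg : Computable g) :
    Computable fun a => f a / g a := Primrec.nat_div.to_comp.comp hf hg

@[fun_prop]
theorem computable_mod {f g : α → ℕ} (hf : Computable f) (hg : Computable g) :
    Computable fun a => f a % g a := Primrec.nat_mod.to_comp.comp hf hg

@[fun_prop]
theorem computable_min {f g : α → ℕ} (hf : Computable f) (hg : Computable g) :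
    Computable fun a => min (f a) (g a) := Primrec.nat_min.to_comp.comp hf hg

@[fun_prop]
theorem computable_max {f g : α → ℕ} (hf : Computable f) (hg : Computable g) :
    Computable fun a => max (f a) (g a) := Primrec.nat_max.to_comp.comp hf hg

@[fun_prop]
theorem computable_sqrt {f : α → ℕ} (hf : Computable f) : Computable fun a => Nat.sqrt (f a) :=
  Primrec.nat_sqrt.to_comp.comp hf

@[fun_prop]
theorem computable_pow {f g : α → ℕ} (hf : Computable f) (hg : Computable g) :
    Computable fun a => f a ^ g a := by
  have h : Primrec₂ fun m n : ℕ => m ^ n := Primrec₂.unpaired'.1 Nat.Primrec.pow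
  exact h.to_comp.comp hf hg

@[fun_prop]
theorem computable_natPair {f g : α → ℕ} (hf : Computable f) (hg : Computable g) :
    Computable fun a => Nat.pair (f a) (g a) := Primrec₂.natPair.to_comp.comp hf hg

@[fun_prop]
theorem computable_unpair {f : α → ℕ} (hf : Computable f) :
    Computable fun a => Nat.unpair (f a) := Computable.unpair.comp hf

@[fun_prop]
theorem computable_decide_lt {f g : α → ℕ} (hf : Computable f) (hg : Computable g) :
    Computable fun a => decide (f a < g a) := Primrec.nat_lt.decide.to_comp.comp hf hg

@[fun_prop]
theorem computable_decide_eq {f g : α → ℕ} (hf : Computable f) (hg : Computable g) :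
    Computable fun a => decide (f a = g a) :=
  ((Primrec.eq (α := ℕ)).decide.to_comp.comp hf hg).of_eq fun _ => rfl

@[fun_prop]
theorem computable_cond {c : α → Bool} {f g : α → σ} (hc : Computable c) (hf : Computable f)
    (hg : Computable g) : Computable fun a => bif c a then f a else g a := hc.cond hf hg

@[fun_prop]
theorem computable_and {f g : α → Bool} (hf : Computable f) (hg : Computable g) :
    Computable fun a => (f a && g a) := Primrec.and.to_comp.comp hf hg

@[fun_prop]
theorem computable_or {f g : α → Bool} (hf : Computable f) (hg : Computable g) :
    Computable fun a => (f a || g a) := Primrec.or.to_comp.comp hf hg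

@[fun_prop]
theorem computable_not {f : α → Bool} (hf : Computable f) : Computable fun a => !(f a) :=
  Primrec.not.to_comp.comp hf

@[fun_prop]
theorem computable_cons {f : α → β} {g : α → List β} (hf : Computable f) (hg : Computable g) :
    Computable fun a => f a :: g a := Computable.list_cons.comp hf hg

@[fun_prop]
theorem computable_append {f g : α → List β} (hf : Computable f) (hg : Computable g) :
    Computable fun a => f a ++ g a := Computable.list_append.comp hf hg

@[fun_prop]
theorem computable_length {f : α → List β} (hf : Computable f) :
    Computable fun a => (f a).length := Computable.list_length.comp hf

@[fun_prop]
theorem computable_range {f : α → ℕ} (hf : Computable f) :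
    Computable fun a => List.range (f a) := Primrec.list_range.to_comp.comp hf

theorem computable_natRec {f : α → ℕ} {g : α → σ} {h : α → ℕ → σ → σ} (hf : Computable f)
    (hg : Computable g) (hh : Computable fun p : α × ℕ × σ => h p.1 p.2.1 p.2.2) :
    Computable fun a => (Nat.rec (g a) (h a) (f a) : σ) :=
  Computable.nat_rec (h := fun a p => h a p.1 p.2) hf hg hh

theorem computable_natCases {f : α → ℕ} {g : α → σ} {h : α → ℕ → σ} (hf : Computable f)
    (hg : Computable g) (hh : Computable fun p : α × ℕ => h p.1 p.2) :
    Computable fun a => (Nat.casesOn (f a) (g a) (h a) : σ) :=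
  Computable.nat_casesOn hf hg hh

theorem natRec_getElem?_eq_foldl {β σ : Type*} (g : σ → β → σ) (b : σ) (l : List β) :
    (Nat.rec b (fun n acc => (Option.casesOn l[n]? acc (fun x => g acc x) : σ)) l.length : σ) =
      l.foldl g b := by
  induction l using List.reverseRecOn with
  | nil => rfl
  | append_singleton l x ih =>
    rw [List.foldl_append, List.foldl_cons, List.foldl_nil, ← ih, List.length_append,
      List.length_singleton]
    have key : ∀ n ≤ l.length,
        (Nat.rec b (fun n acc => (Option.casesOn (l ++ [x])[n]? acc (fun x => g acc x) : σ)) n : σ)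
        = Nat.rec b (fun n acc => (Option.casesOn l[n]? acc (fun x => g acc x) : σ)) n := by
      intro n
      induction n with
      | zero => intro _; rfl
      | succ n ihn =>
        intro hn
        have := ihn (by omega)
        simp only at this ⊢
        rw [this, List.getElem?_append_left (by omega)]
    simp only [key _ le_rfl]
    simp

@[fun_prop]
theorem computable_foldl {f : α → List β} {b : α → σ} {g : α → σ → β → σ} (hf : Computable f)
    (hb : Computable b) (hg : Computable fun p : α × σ × β => g p.1 p.2.1 p.2.2) :
    Computable fun a => (f a).foldl (g a) (b a) := by
  refine (computable_natRec (f := fun a => (f a).length) (g := b)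
    (h := fun a n acc => (Option.casesOn (f a)[n]? acc (fun x => g a acc x) : σ))
    (by fun_prop) hb ?_).of_eq fun a => natRec_getElem?_eq_foldl (g a) (b a) (f a)
  refine Computable.option_casesOn (o := fun p : α × ℕ × σ => (f p.1)[p.2.1]?)
    (g := fun p x => g p.1 p.2.2 x) ?_ (by fun_prop) ?_
  · exact Computable.list_getElem?.comp (by fun_prop) (by fun_prop)
  · exact hg.comp (g := fun q : (α × ℕ × σ) × β => (q.1.1, q.1.2.2, q.2)) (by fun_prop)

theorem foldl_append_eq_flatMap {β σ : Type*} (g : β → List σ) (l : List β) (acc : List σ) :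
    l.foldl (fun acc x => acc ++ g x) acc = acc ++ l.flatMap g := by
  induction l generalizing acc with
  | nil => simp
  | cons x l ih => simp [ih, List.flatMap_cons]

@[fun_prop]
theorem computable_flatMap {f : α → List β} {g : α → β → List σ} (hf : Computable f)
    (hg : Computable fun p : α × β => g p.1 p.2) :
    Computable fun a => (f a).flatMap (g a) := by
  have hg' : Computable fun p : α × List σ × β => g p.1 p.2.2 :=
    hg.comp (g := fun p : α × List σ × β => (p.1, p.2.2)) (by fun_prop)
  refine (computable_foldl (b := fun _ => []) (g := fun a acc x => acc ++ g a x) hf (by fun_prop)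
    (by fun_prop)).of_eq fun a => ?_
  rw [foldl_append_eq_flatMap, List.nil_append]

@[fun_prop]
theorem computable_map {f : α → List β} {g : α → β → σ} (hf : Computable f)
    (hg : Computable fun p : α × β => g p.1 p.2) :
    Computable fun a => (f a).map (g a) := by
  refine (computable_flatMap (g := fun a x => [g a x]) hf (by fun_prop)).of_eq fun a => ?_
  simp [← List.map_eq_flatMap]

@[fun_prop]
theorem computable_list_sum {f : α → List ℕ} (hf : Computable f) :
    Computable fun a => (f a).sum := by
  refine (computable_foldl (b := fun _ => 0) (g := fun _ (s : ℕ) x => s + x) hf (by fun_prop)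
    (by fun_prop)).of_eq fun a => ?_
  rw [List.sum_eq_foldl]

@[fun_prop]
theorem computable_all {f : α → List β} {g : α → β → Bool} (hf : Computable f)
    (hg : Computable fun p : α × β => g p.1 p.2) :
    Computable fun a => (f a).all (g a) := by
  have hg' : Computable fun p : α × Bool × β => g p.1 p.2.2 :=
    hg.comp (g := fun p : α × Bool × β => (p.1, p.2.2)) (by fun_prop)
  refine (computable_foldl (b := fun _ => true) (g := fun a (s : Bool) x => s && g a x) hf
    (by fun_prop) (by fun_prop)).of_eq fun a => ?_
  have : ∀ (l : List β) (s : Bool), l.foldl (fun s x => s && g a x) s = (s && l.all (g a)) := by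
    intro l
    induction l with
    | nil => simp
    | cons x l ih => intro s; simp [ih, Bool.and_assoc]
  simp [this]

/-- Unbounded search for a witness of a decidable property that always has one. -/
theorem exists_computable_search {P : α → ℕ → Bool} (hP : Computable fun p : α × ℕ => P p.1 p.2)
    (h : ∀ a, ∃ n, P a n = true) : ∃ f : α → ℕ, Computable f ∧ ∀ a, P a (f a) = true := by
  refine ⟨fun a => Nat.find (h a), ?_, fun a => Nat.find_spec (h a)⟩
  have hp : Partrec₂ fun (a : α) (n : ℕ) => (Part.some (P a n) : Part Bool) := hP.partrec
  refine (Partrec.rfind hp).of_eq_tot fun a => ?_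
  refine Nat.mem_rfind.2 ⟨?_, fun {m} hm => ?_⟩
  · exact Part.mem_some_iff.2 (Nat.find_spec (h a)).symm
  · exact Part.mem_some_iff.2 (Bool.eq_false_of_not_eq_true (Nat.find_min (h a) hm)).symm

end Computability

section Codes

def RatCode.add (p q : RatCode) : RatCode :=
  (p.1 * (q.2.2 + 1) + q.1 * (p.2.2 + 1), p.2.1 * (q.2.2 + 1) + q.2.1 * (p.2.2 + 1),
    p.2.2 * q.2.2 + p.2.2 + q.2.2)

def RatCode.mul (p q : RatCode) : RatCode :=
  (p.1 * q.1 + p.2.1 * q.2.1, p.1 * q.2.1 + p.2.1 * q.1, p.2.2 * q.2.2 + p.2.2 + q.2.2)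

def RatCode.neg (p : RatCode) : RatCode := (p.2.1, p.1, p.2.2)

theorem RatCode.val_add (p q : RatCode) : (p.add q).val = p.val + q.val := by
  simp only [RatCode.val, RatCode.add]; push_cast
  field_simp; ring

theorem RatCode.val_mul (p q : RatCode) : (p.mul q).val = p.val * q.val := by
  simp only [RatCode.val, RatCode.mul]; push_cast
  field_simp; ring

theorem RatCode.val_neg (p : RatCode) : p.neg.val = -p.val := by
  simp only [RatCode.val, RatCode.neg]
  field_simp; ring

def GaussCode.add (c d : GaussCode) : GaussCode := (RatCode.add c.1 d.1, RatCode.add c.2 d.2)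

def GaussCode.mul (c d : GaussCode) : GaussCode :=
  (RatCode.add (RatCode.mul c.1 d.1) (RatCode.neg (RatCode.mul c.2 d.2)),
    RatCode.add (RatCode.mul c.1 d.2) (RatCode.mul c.2 d.1))

def GaussCode.neg (c : GaussCode) : GaussCode := (RatCode.neg c.1, RatCode.neg c.2)

theorem GaussCode.val_add (c d : GaussCode) : (c.add d).val = c.val + d.val := by
  apply Complex.ext <;> simp [GaussCode.val, GaussCode.add, RatCode.val_add]

theorem GaussCode.val_mul (c d : GaussCode) : (c.mul d).val = c.val * d.val := by
  apply Complex.ext <;>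
    simp [GaussCode.val, GaussCode.mul, RatCode.val_add, RatCode.val_mul, RatCode.val_neg,
      sub_eq_add_neg]

theorem GaussCode.val_neg (c : GaussCode) : c.neg.val = -c.val := by
  apply Complex.ext <;> simp [GaussCode.val, GaussCode.neg, RatCode.val_neg]

theorem RatCode.exists_val_eq (q : ℚ) : ∃ c : RatCode, c.val = q := by
  refine ⟨(q.num.toNat, (-q.num).toNat, q.den - 1), ?_⟩
  have hd : ((q.den - 1 : ℕ) : ℚ) + 1 = q.den := by
    have := q.den_pos
    rw [Nat.cast_sub (by omega)]; simp
  have hn : ((q.num.toNat : ℕ) : ℚ) - ((-q.num).toNat : ℕ) = q.num := by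
    have : ((q.num.toNat : ℕ) : ℤ) - ((-q.num).toNat : ℕ) = q.num := Int.toNat_sub_toNat_neg _
    exact_mod_cast this
  simp only [RatCode.val, hd, hn, Rat.num_div_den]

theorem GaussCode.denseRange_val : DenseRange GaussCode.val := by
  have h1 : DenseRange fun c : RatCode => ((c.val : ℚ) : ℝ) :=
    (Rat.isDenseEmbedding_coe_real.dense).comp
      (Function.Surjective.denseRange RatCode.exists_val_eq) Rat.continuous_coe_real
  have h2 := h1.prodMap h1
  have h3 := (Complex.equivRealProdCLM.symm.surjective.denseRange).comp h2
    Complex.equivRealProdCLM.symm.continuous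
  convert h3 using 1
  funext c
  apply Complex.ext <;> simp [GaussCode.val]

variable {α : Type*} [Primcodable α]

@[fun_prop]
theorem RatCode.computable_add {f g : α → RatCode} (hf : Computable f) (hg : Computable g) :
    Computable fun a => (f a).add (g a) := by
  unfold RatCode.add; fun_prop

@[fun_prop]
theorem RatCode.computable_mul {f g : α → RatCode} (hf : Computable f) (hg : Computable g) :
    Computable fun a => (f a).mul (g a) := by
  unfold RatCode.mul; fun_prop

@[fun_prop]
theorem RatCode.computable_neg {f : α → RatCode} (hf : Computable f) :
    Computable fun a => (f a).neg := by
  unfold RatCode.neg; fun_prop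

@[fun_prop]
theorem GaussCode.computable_add {f g : α → GaussCode} (hf : Computable f) (hg : Computable g) :
    Computable fun a => (f a).add (g a) := by
  unfold GaussCode.add; fun_prop

@[fun_prop]
theorem GaussCode.computable_mul {f g : α → GaussCode} (hf : Computable f) (hg : Computable g) :
    Computable fun a => (f a).mul (g a) := by
  unfold GaussCode.mul; fun_prop

@[fun_prop]
theorem GaussCode.computable_neg {f : α → GaussCode} (hf : Computable f) :
    Computable fun a => (f a).neg := by
  unfold GaussCode.neg; fun_prop

end Codes

section Evaluation

theorem RatStarPoly.eval_cons {A : Type*} [NonUnitalCStarAlgebra A] (v : ℕ → A) (m : RatMonomial)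
    (p : RatStarPoly) :
    RatStarPoly.eval v (m :: p) = RatMonomial.eval v m + RatStarPoly.eval v p := by
  simp [RatStarPoly.eval]

theorem RatStarPoly.eval_append {A : Type*} [NonUnitalCStarAlgebra A] (v : ℕ → A)
    (p q : RatStarPoly) :
    RatStarPoly.eval v (p ++ q) = RatStarPoly.eval v p + RatStarPoly.eval v q := by
  simp [RatStarPoly.eval]

theorem Letter.eval_map {A B F : Type*} [NonUnitalCStarAlgebra A] [NonUnitalCStarAlgebra B]
    [FunLike F A B] [StarHomClass F A B] (φ : F) (v : ℕ → A) (l : Letter) :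
    Letter.eval (fun n => φ (v n)) l = φ (Letter.eval v l) := by
  rcases l with ⟨n, _ | _⟩ <;> simp [Letter.eval, map_star]

theorem RatMonomial.eval_map {A B F : Type*} [NonUnitalCStarAlgebra A] [NonUnitalCStarAlgebra B]
    [FunLike F A B] [NonUnitalAlgHomClass F ℂ A B] [StarHomClass F A B] (φ : F) (v : ℕ → A)
    (m : RatMonomial) :
    RatMonomial.eval (fun n => φ (v n)) m = φ (RatMonomial.eval v m) := by
  rcases m with ⟨c, l, w⟩
  simp only [RatMonomial.eval, map_smul]
  congr 1
  rw [Letter.eval_map]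
  induction w using List.reverseRecOn with
  | nil => rfl
  | append_singleton w x ih =>
    simp only [List.foldl_append, List.foldl_cons, List.foldl_nil, Letter.eval_map,
      map_mul] at ih ⊢
    rw [ih]

theorem RatStarPoly.eval_map {A B F : Type*} [NonUnitalCStarAlgebra A] [NonUnitalCStarAlgebra B]
    [FunLike F A B] [NonUnitalAlgHomClass F ℂ A B] [StarHomClass F A B] (φ : F) (v : ℕ → A)
    (p : RatStarPoly) :
    RatStarPoly.eval (fun n => φ (v n)) p = φ (RatStarPoly.eval v p) := by
  induction p with
  | nil => simp [RatStarPoly.eval]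
  | cons m p ih => rw [eval_cons, eval_cons, ih, RatMonomial.eval_map, map_add]

theorem foldl_letter_eq_mul_prod {A : Type*} [CStarAlgebra A] (v : ℕ → A) (a : A)
    (w : List Letter) :
    w.foldl (fun a l => a * Letter.eval v l) a = a * (w.map (Letter.eval v)).prod := by
  induction w generalizing a with
  | nil => simp
  | cons l w ih => simp [ih, mul_assoc]

end Evaluation

/-- Unital rational `*`-polynomials, where the empty word is allowed. -/
abbrev UnitalPoly : Type := List (GaussCode × List Letter)

namespace UnitalPoly

def mul (p q : UnitalPoly) : UnitalPoly :=
  p.flatMap fun m => q.map fun m' => (m.1.mul m'.1, m.2 ++ m'.2)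

def neg (p : UnitalPoly) : UnitalPoly := p.map fun m => (m.1.neg, m.2)

/-- The product of a non-unital and a unital polynomial. -/
def mulLeft (e : RatStarPoly) (p : UnitalPoly) : RatStarPoly :=
  e.flatMap fun m => p.map fun m' => (m.1.mul m'.1, m.2.1, m.2.2 ++ m'.2)

def ofRatStarPoly (p : RatStarPoly) : UnitalPoly := p.map fun m => (m.1, m.2.1 :: m.2.2)

/-- Non-unital approximations of a unital polynomial `p`: if `e` is close to the unit, then they
converge to `p`. -/
def approx (e : RatStarPoly) (p : UnitalPoly) (N : ℕ) : RatStarPoly :=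
  Nat.rec [] (fun _ t => t ++ mulLeft e (p ++ neg (ofRatStarPoly t))) N

section Computable

variable {α : Type*} [Primcodable α]

@[fun_prop]
theorem computable_mul {f g : α → UnitalPoly} (hf : Computable f) (hg : Computable g) :
    Computable fun a => mul (f a) (g a) := by
  unfold mul; fun_prop

@[fun_prop]
theorem computable_neg {f : α → UnitalPoly} (hf : Computable f) :
    Computable fun a => neg (f a) := by
  unfold neg; fun_prop

@[fun_prop]
theorem computable_approx (e : RatStarPoly) {f : α → UnitalPoly} {g : α → ℕ} (hf : Computable f)
    (hg : Computable g) : Computable fun a => approx e (f a) (g a) := by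
  unfold approx mulLeft ofRatStarPoly
  exact computable_natRec hg (by fun_prop) (by fun_prop)

end Computable

section Eval

variable {A : Type*} [CStarAlgebra A] (v : ℕ → A)

noncomputable def eval (p : UnitalPoly) : A :=
  (p.map fun m => GaussCode.val m.1 • (m.2.map (Letter.eval v)).prod).sum

@[simp]
theorem eval_nil : eval v [] = 0 := rfl

@[simp]
theorem eval_cons (m : GaussCode × List Letter) (p : UnitalPoly) :
    eval v (m :: p) = GaussCode.val m.1 • (m.2.map (Letter.eval v)).prod + eval v p := by
  simp [eval]

theorem eval_append (p q : UnitalPoly) : eval v (p ++ q) = eval v p + eval v q := by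
  simp [eval]

theorem eval_flatMap {β : Type*} (l : List β) (f : β → UnitalPoly) :
    eval v (l.flatMap f) = (l.map fun x => eval v (f x)).sum := by
  induction l with
  | nil => simp
  | cons x l ih => simp [List.flatMap_cons, eval_append, ih]

theorem eval_neg (p : UnitalPoly) : eval v (neg p) = -eval v p := by
  induction p with
  | nil => simp [neg]
  | cons m p ih =>
    have : neg (m :: p) = (m.1.neg, m.2) :: neg p := rfl
    rw [this, eval_cons, eval_cons, ih, GaussCode.val_neg]
    simp [add_comm]

theorem eval_map_monomial (c : GaussCode) (w : List Letter) (q : UnitalPoly) :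
    eval v (q.map fun m' => (c.mul m'.1, w ++ m'.2)) =
      (GaussCode.val c • (w.map (Letter.eval v)).prod) * eval v q := by
  induction q with
  | nil => simp
  | cons m q ih =>
    simp [ih, mul_add, GaussCode.val_mul, smul_smul, mul_comm]

theorem eval_mul (p q : UnitalPoly) : eval v (mul p q) = eval v p * eval v q := by
  induction p with
  | nil => simp [mul]
  | cons m p ih =>
    have : mul (m :: p) q = (q.map fun m' => (m.1.mul m'.1, m.2 ++ m'.2)) ++ mul p q := rfl
    rw [this, eval_append, ih, eval_map_monomial, eval_cons, add_mul]

theorem eval_ofRatStarPoly (p : RatStarPoly) : eval v (ofRatStarPoly p) = p.eval v := by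
  induction p with
  | nil => rfl
  | cons m p ih =>
    have : ofRatStarPoly (m :: p) = (m.1, m.2.1 :: m.2.2) :: ofRatStarPoly p := rfl
    rw [this, eval_cons, ih, RatStarPoly.eval_cons, RatMonomial.eval, foldl_letter_eq_mul_prod]
    simp

theorem ofRatStarPoly_mulLeft (e : RatStarPoly) (p : UnitalPoly) :
    ofRatStarPoly (mulLeft e p) = mul (ofRatStarPoly e) p := by
  simp only [ofRatStarPoly, mulLeft, mul, List.map_flatMap, List.flatMap_map, List.map_map]
  rfl

theorem eval_mulLeft (e : RatStarPoly) (p : UnitalPoly) :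
    (mulLeft e p).eval v = e.eval v * eval v p := by
  rw [← eval_ofRatStarPoly, ofRatStarPoly_mulLeft, eval_mul, eval_ofRatStarPoly]

theorem sub_eval_approx (e : RatStarPoly) (p : UnitalPoly) (N : ℕ) :
    eval v p - (approx e p N).eval v = (1 - e.eval v) ^ N * eval v p := by
  induction N with
  | zero => simp [approx, RatStarPoly.eval]
  | succ N ih =>
    have : approx e p (N + 1) =
        approx e p N ++ mulLeft e (p ++ neg (ofRatStarPoly (approx e p N))) := rfl
    rw [this, RatStarPoly.eval_append, eval_mulLeft, eval_append, eval_neg, eval_ofRatStarPoly,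
      pow_succ', mul_assoc, ← ih]
    noncomm_ring

theorem norm_eval_sub_approx_le {e : RatStarPoly} (he : ‖1 - e.eval v‖ ≤ 1 / 2) (p : UnitalPoly)
    (N : ℕ) : ‖eval v p - (approx e p N).eval v‖ ≤ (1 / 2) ^ N * ‖eval v p‖ := by
  rw [sub_eval_approx]
  induction N with
  | zero => simp
  | succ N ih =>
    rw [pow_succ', pow_succ', mul_assoc, mul_assoc]
    exact (norm_mul_le _ _).trans (mul_le_mul he ih (norm_nonneg _) (by norm_num))

end Eval

end UnitalPoly

section Density

variable {A : Type*} [CStarAlgebra A]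

theorem smul_mem_closure_range_eval (v : ℕ → A) (z : ℂ) {y : A}
    (hy : y ∈ closure (Set.range (RatStarPoly.eval v))) :
    z • y ∈ closure (Set.range (RatStarPoly.eval v)) := by
  refine map_mem_closure₂ (f := fun (z : ℂ) (y : A) => z • y) (s := Set.range GaussCode.val)
    (by fun_prop) (GaussCode.denseRange_val z) hy ?_
  rintro _ ⟨c, rfl⟩ _ ⟨p, rfl⟩
  refine ⟨p.map fun m => (c.mul m.1, m.2), ?_⟩
  induction p with
  | nil => simp [RatStarPoly.eval]
  | cons m p ih =>
    rw [List.map_cons, RatStarPoly.eval_cons, RatStarPoly.eval_cons, ih, smul_add]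
    simp [RatMonomial.eval, GaussCode.val_mul, smul_smul]

theorem add_mem_closure_range_eval (v : ℕ → A) {x y : A}
    (hx : x ∈ closure (Set.range (RatStarPoly.eval v)))
    (hy : y ∈ closure (Set.range (RatStarPoly.eval v))) :
    x + y ∈ closure (Set.range (RatStarPoly.eval v)) := by
  refine map_mem_closure₂ (f := fun x y : A => x + y) (by fun_prop) hx hy ?_
  rintro _ ⟨p, rfl⟩ _ ⟨q, rfl⟩
  exact ⟨p ++ q, RatStarPoly.eval_append v p q⟩

theorem exists_word_of_mem_closure (v : ℕ → A) {x : A}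
    (hx : x ∈ Subsemigroup.closure (Set.range v ∪ star (Set.range v))) :
    ∃ (l : Letter) (w : List Letter), x = Letter.eval v l * (w.map (Letter.eval v)).prod := by
  induction hx using Subsemigroup.closure_induction with
  | mem x hx =>
    rcases hx with ⟨n, rfl⟩ | hx
    · exact ⟨(n, false), [], by simp [Letter.eval]⟩
    · obtain ⟨n, hn⟩ := hx
      exact ⟨(n, true), [], by simp [Letter.eval, hn]⟩
  | mul x y _ _ hx hy =>
    obtain ⟨l, w, rfl⟩ := hx
    obtain ⟨l', w', rfl⟩ := hy
    exact ⟨l, w ++ l' :: w', by simp [mul_assoc]⟩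

theorem CStarPresentation.denseRange_eval (P : CStarPresentation A) :
    DenseRange (RatStarPoly.eval P.vec) := by
  have key : (NonUnitalStarAlgebra.adjoin ℂ (Set.range P.vec) : Set A) ⊆
      closure (Set.range (RatStarPoly.eval P.vec)) := by
    intro x hx
    rw [SetLike.mem_coe, ← NonUnitalStarSubalgebra.mem_toNonUnitalSubalgebra,
      ← NonUnitalSubalgebra.mem_toSubmodule, NonUnitalStarAlgebra.adjoin_eq_span] at hx
    induction hx using Submodule.span_induction with
    | mem x hx =>
      obtain ⟨l, w, rfl⟩ := exists_word_of_mem_closure P.vec hx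
      have h1 : Letter.eval P.vec l * (w.map (Letter.eval P.vec)).prod ∈
          closure (Set.range (RatStarPoly.eval P.vec)) := by
        refine subset_closure ⟨[(((1, 0, 0), (0, 0, 0)), l, w)], ?_⟩
        have hc : GaussCode.val ((1, 0, 0), (0, 0, 0)) = 1 := by
          apply Complex.ext <;> simp [GaussCode.val, RatCode.val]
        simp [RatStarPoly.eval, RatMonomial.eval, foldl_letter_eq_mul_prod, hc]
      exact h1
    | zero => exact subset_closure ⟨[], rfl⟩
    | add x y _ _ hx hy => exact add_mem_closure_range_eval _ hx hy
    | smul z x _ hx => exact smul_mem_closure_range_eval _ z hx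
  have := P.dense_adjoin.mono key
  rwa [dense_closure] at this

end Density

section Transfer

theorem ComputablyPresentable.of_starAlgEquiv {A B : Type*} [CStarAlgebra A] [CStarAlgebra B]
    (φ : A ≃⋆ₐ[ℂ] B) (h : ComputablyPresentable A) : ComputablyPresentable B := by
  obtain ⟨P, f, hf, hP⟩ := h
  have hiso : Isometry φ := StarAlgEquiv.isometry φ
  refine ⟨⟨fun n => φ (P.vec n), ?_⟩, f, hf, fun p k => ?_⟩
  · have h1 : Dense (φ '' (NonUnitalStarAlgebra.adjoin ℂ (Set.range P.vec) : Set A)) :=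
      φ.surjective.denseRange.dense_image hiso.continuous P.dense_adjoin
    refine h1.mono ?_
    have h2 := NonUnitalStarAlgHom.map_adjoin (φ : A →⋆ₙₐ[ℂ] B) (Set.range P.vec)
    rw [← Set.range_comp] at h2
    have h3 := congrArg (fun S : NonUnitalStarSubalgebra ℂ B => (S : Set B)) h2
    rw [NonUnitalStarSubalgebra.coe_map] at h3
    exact h3.subset
  · have h1 : RatStarPoly.eval (fun n => φ (P.vec n)) p = φ (RatStarPoly.eval P.vec p) :=
      RatStarPoly.eval_map φ P.vec p
    rw [h1, hiso.norm_map_of_map_zero (map_zero φ)]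
    exact hP p k

end Transfer

section RationalEvaluation

/-- The value of a rational `*`-polynomial at a sequence of rational numbers. -/
def evalCode (u : ℕ → RatCode) (p : RatStarPoly) : GaussCode :=
  p.foldl (fun acc m => acc.add (m.2.2.foldl (fun c l => c.mul (u l.1, (0, 0, 0)))
    (m.1.mul (u m.2.1.1, (0, 0, 0))))) ((0, 0, 0), (0, 0, 0))

theorem computable_evalCode {α : Type*} [Primcodable α] {u : α × ℕ → RatCode} {f : α → RatStarPoly}
    (hu : Computable u) (hf : Computable f) :
    Computable fun a => evalCode (fun n => u (a, n)) (f a) := by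
  unfold evalCode; fun_prop

theorem GaussCode.val_ratCode (q : RatCode) :
    GaussCode.val (q, (0, 0, 0)) = (((q.val : ℚ) : ℝ) : ℂ) := by
  have h : RatCode.val (0, 0, 0) = 0 := by simp [RatCode.val]
  apply Complex.ext <;> simp [GaussCode.val, h]

theorem Letter.eval_ofReal (u : ℕ → ℝ) (l : Letter) :
    Letter.eval (fun n => (u n : ℂ)) l = u l.1 := by
  rcases l with ⟨n, _ | _⟩ <;> simp [Letter.eval]

theorem val_evalCode (u : ℕ → RatCode) (p : RatStarPoly) :
    (evalCode u p).val = p.eval fun n => ((((u n).val : ℚ) : ℝ) : ℂ) := by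
  have hm (m : RatMonomial) : GaussCode.val (m.2.2.foldl (fun c l => c.mul (u l.1, (0, 0, 0)))
      (m.1.mul (u m.2.1.1, (0, 0, 0)))) =
        m.eval fun n => ((((u n).val : ℚ) : ℝ) : ℂ) := by
    rcases m with ⟨c, l, w⟩
    rw [RatMonomial.eval]
    induction w using List.reverseRecOn with
    | nil =>
      simp only [List.foldl_nil, GaussCode.val_mul, GaussCode.val_ratCode, Letter.eval_ofReal,
        smul_eq_mul]
    | append_singleton w x ih =>
      simp only [List.foldl_append, List.foldl_cons, List.foldl_nil, GaussCode.val_mul, ih,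
        GaussCode.val_ratCode, Letter.eval_ofReal, smul_eq_mul, mul_assoc]
  have h0 : ∀ acc : GaussCode, (p.foldl (fun acc m => acc.add
      (m.2.2.foldl (fun c l => c.mul (u l.1, (0, 0, 0)))
        (m.1.mul (u m.2.1.1, (0, 0, 0))))) acc).val =
      acc.val + p.eval fun n => ((((u n).val : ℚ) : ℝ) : ℂ) := by
    induction p with
    | nil => simp [RatStarPoly.eval]
    | cons m p ih =>
      intro acc
      rw [List.foldl_cons, ih, GaussCode.val_add, hm, RatStarPoly.eval_cons, add_assoc]
  have hz : GaussCode.val ((0, 0, 0), (0, 0, 0)) = 0 := by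
    apply Complex.ext <;> simp [GaussCode.val, RatCode.val]
  rw [evalCode, h0, hz, zero_add]

/-- A Lipschitz constant of the function `z ↦ p(z)` on the unit polydisc. -/
def lipBound (p : RatStarPoly) : ℕ :=
  (p.map fun m => (m.1.1.1 + m.1.1.2.1 + m.1.2.1 + m.1.2.2.1) * (m.2.2.length + 1)).sum

@[fun_prop]
theorem computable_lipBound {α : Type*} [Primcodable α] {f : α → RatStarPoly}
    (hf : Computable f) : Computable fun a => lipBound (f a) := by
  unfold lipBound; fun_prop

theorem RatCode.abs_val_le (q : RatCode) : |(q.val : ℝ)| ≤ q.1 + q.2.1 := by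
  simp only [RatCode.val]; push_cast
  have h1 : (1 : ℝ) ≤ (q.2.2 : ℝ) + 1 := by simp
  rw [abs_div, abs_of_pos (by positivity : (0 : ℝ) < (q.2.2 : ℝ) + 1)]
  refine (div_le_self (abs_nonneg _) h1).trans ((abs_sub _ _).trans ?_)
  simp

theorem GaussCode.norm_val_le (c : GaussCode) :
    ‖c.val‖ ≤ ((c.1.1 + c.1.2.1 + c.2.1 + c.2.2.1 : ℕ) : ℝ) := by
  refine (Complex.norm_le_abs_re_add_abs_im _).trans ?_
  have h1 := RatCode.abs_val_le c.1
  have h2 := RatCode.abs_val_le c.2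
  simp only [GaussCode.val]; push_cast
  linarith

theorem Letter.norm_eval (z : ℕ → ℂ) (l : Letter) : ‖Letter.eval z l‖ = ‖z l.1‖ := by
  rcases l with ⟨n, _ | _⟩ <;> simp [Letter.eval]

theorem Letter.norm_eval_sub (z z' : ℕ → ℂ) (l : Letter) :
    ‖Letter.eval z l - Letter.eval z' l‖ = ‖z l.1 - z' l.1‖ := by
  rcases l with ⟨n, _ | _⟩ <;> simp [Letter.eval, ← map_sub]

theorem norm_word_le_one {z : ℕ → ℂ} (hz : ∀ n, ‖z n‖ ≤ 1) (l : Letter) (w : List Letter) :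
    ‖w.foldl (fun a l => a * Letter.eval z l) (Letter.eval z l)‖ ≤ 1 := by
  induction w using List.reverseRecOn with
  | nil => simpa [Letter.norm_eval] using hz _
  | append_singleton w x ih =>
    simp only [List.foldl_append, List.foldl_cons, List.foldl_nil, norm_mul, Letter.norm_eval]
    exact mul_le_one₀ ih (norm_nonneg _) (hz _)

theorem norm_word_sub_le {z z' : ℕ → ℂ} {ε : ℝ} (hz : ∀ n, ‖z n‖ ≤ 1) (hz' : ∀ n, ‖z' n‖ ≤ 1)
    (hε : ∀ n, ‖z n - z' n‖ ≤ ε) (l : Letter) (w : List Letter) :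
    ‖w.foldl (fun a l => a * Letter.eval z l) (Letter.eval z l) -
      w.foldl (fun a l => a * Letter.eval z' l) (Letter.eval z' l)‖ ≤ (w.length + 1) * ε := by
  have hε0 : 0 ≤ ε := (norm_nonneg _).trans (hε 0)
  induction w using List.reverseRecOn with
  | nil => simpa [Letter.norm_eval_sub] using hε _
  | append_singleton w x ih =>
    simp only [List.foldl_append, List.foldl_cons, List.foldl_nil, List.length_append,
      List.length_cons, List.length_nil]
    set a := w.foldl (fun a l => a * Letter.eval z l) (Letter.eval z l)
    set b := w.foldl (fun a l => a * Letter.eval z' l) (Letter.eval z' l) with hb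
    have hb1 : ‖b‖ ≤ 1 := norm_word_le_one hz' l w
    calc ‖a * Letter.eval z x - b * Letter.eval z' x‖
        = ‖(a - b) * Letter.eval z x + b * (Letter.eval z x - Letter.eval z' x)‖ := by
          congr 1; ring
      _ ≤ ‖a - b‖ * ‖Letter.eval z x‖ + ‖b‖ * ‖Letter.eval z x - Letter.eval z' x‖ := by
          refine (norm_add_le _ _).trans ?_
          rw [norm_mul, norm_mul]
      _ ≤ (w.length + 1) * ε * 1 + 1 * ε := by
          rw [Letter.norm_eval, Letter.norm_eval_sub]
          gcongr
          · exact hz _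
          · exact hε _
      _ = _ := by push_cast; ring

theorem norm_eval_sub_eval_le {z z' : ℕ → ℂ} {ε : ℝ} (hz : ∀ n, ‖z n‖ ≤ 1)
    (hz' : ∀ n, ‖z' n‖ ≤ 1) (hε : ∀ n, ‖z n - z' n‖ ≤ ε) (p : RatStarPoly) :
    ‖p.eval z - p.eval z'‖ ≤ lipBound p * ε := by
  have hε0 : 0 ≤ ε := (norm_nonneg _).trans (hε 0)
  induction p with
  | nil => simp [RatStarPoly.eval, lipBound]
  | cons m p ih =>
    have hl : lipBound (m :: p) =
        (m.1.1.1 + m.1.1.2.1 + m.1.2.1 + m.1.2.2.1) * (m.2.2.length + 1) + lipBound p := by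
      simp [lipBound]
    rw [RatStarPoly.eval_cons, RatStarPoly.eval_cons, add_sub_add_comm, hl, Nat.cast_add, add_mul,
      Nat.cast_mul, mul_assoc, RatMonomial.eval, RatMonomial.eval, ← smul_sub]
    refine (norm_add_le _ _).trans (add_le_add ?_ ih)
    rw [norm_smul]
    have := norm_word_sub_le hz hz' hε m.2.1 m.2.2
    exact mul_le_mul (GaussCode.norm_val_le _) (by exact_mod_cast this) (norm_nonneg _)
      (by positivity)

end RationalEvaluation

section RationalModulus

/-- The rounding of `2 ^ k * |c|` to a natural number. -/
def GaussCode.scaledNorm (c : GaussCode) (k : ℕ) : ℕ :=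
  let q := RatCode.add (RatCode.mul c.1 c.1) (RatCode.mul c.2 c.2)
  Nat.sqrt ((q.1 - q.2.1) * 4 ^ k / (q.2.2 + 1))

@[fun_prop]
theorem GaussCode.computable_scaledNorm {α : Type*} [Primcodable α] {f : α → GaussCode}
    {g : α → ℕ} (hf : Computable f) (hg : Computable g) :
    Computable fun a => (f a).scaledNorm (g a) := by
  unfold GaussCode.scaledNorm; fun_prop

theorem GaussCode.scaledNorm_le_and_lt (c : GaussCode) (k : ℕ) :
    (c.scaledNorm k : ℝ) ≤ 2 ^ k * ‖c.val‖ ∧ 2 ^ k * ‖c.val‖ < c.scaledNorm k + 1 := by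
  set q := RatCode.add (RatCode.mul c.1 c.1) (RatCode.mul c.2 c.2) with hq
  have hv : (q.val : ℝ) = ‖c.val‖ ^ 2 := by
    rw [← Complex.normSq_eq_norm_sq, Complex.normSq_apply, hq, RatCode.val_add, RatCode.val_mul,
      RatCode.val_mul]
    simp [GaussCode.val]
  have hd : (0 : ℝ) < (q.2.2 : ℝ) + 1 := by positivity
  have hv2 : ((q.1 : ℝ) - q.2.1) = ‖c.val‖ ^ 2 * (q.2.2 + 1) := by
    rw [← hv, RatCode.val]; push_cast; field_simp
  have hle : q.2.1 ≤ q.1 := by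
    have : (0 : ℝ) ≤ (q.1 : ℝ) - q.2.1 := by rw [hv2]; positivity
    exact_mod_cast sub_nonneg.1 this
  have h4 : (4 : ℝ) ^ k = (2 ^ k) ^ 2 := by
    rw [← pow_mul, mul_comm, pow_mul]; norm_num
  have hm : (((q.1 - q.2.1) * 4 ^ k : ℕ) : ℝ) = (2 ^ k * ‖c.val‖) ^ 2 * (q.2.2 + 1) := by
    push_cast [Nat.cast_sub hle]
    rw [hv2, h4]; ring
  have hs : c.scaledNorm k = Nat.sqrt ((q.1 - q.2.1) * 4 ^ k / (q.2.2 + 1)) := rfl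
  set s := c.scaledNorm k
  set y := (q.1 - q.2.1) * 4 ^ k
  constructor
  · have h1 : s ^ 2 * (q.2.2 + 1) ≤ y :=
      (Nat.le_div_iff_mul_le (by omega)).1 (hs ▸ Nat.sqrt_le' _)
    have h2 : ((s : ℝ)) ^ 2 * (q.2.2 + 1) ≤ (2 ^ k * ‖c.val‖) ^ 2 * (q.2.2 + 1) := by
      rw [← hm]; exact_mod_cast h1
    exact (abs_le_of_sq_le_sq' (le_of_mul_le_mul_right h2 hd) (by positivity)).2
  · have h1 : y < (s + 1) ^ 2 * (q.2.2 + 1) :=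
      (Nat.div_lt_iff_lt_mul (by omega)).1 (hs ▸ Nat.lt_succ_sqrt' _)
    have h2 : (2 ^ k * ‖c.val‖) ^ 2 * (q.2.2 + 1) < ((s : ℝ) + 1) ^ 2 * (q.2.2 + 1) := by
      rw [← hm]; exact_mod_cast h1
    exact (abs_lt_of_sq_lt_sq' (lt_of_mul_lt_mul_right h2 hd.le) (by positivity)).2

end RationalModulus

theorem le_foldl_max {β : Type*} (q : β → ℕ) (l : List β) (b : ℕ) :
    b ≤ l.foldl (fun acc j => max acc (q j)) b ∧
      ∀ j ∈ l, q j ≤ l.foldl (fun acc j => max acc (q j)) b := by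
  induction l generalizing b with
  | nil => simp
  | cons x l ih =>
    obtain ⟨h1, h2⟩ := ih (max b (q x))
    simp only [List.foldl_cons, List.mem_cons, forall_eq_or_imp]
    exact ⟨(le_max_left _ _).trans h1, (le_max_right _ _).trans h1, h2⟩

theorem foldl_max_eq_or_exists {β : Type*} (q : β → ℕ) (l : List β) (b : ℕ) :
    l.foldl (fun acc j => max acc (q j)) b = b ∨
      ∃ j ∈ l, l.foldl (fun acc j => max acc (q j)) b = q j := by
  induction l generalizing b with
  | nil => simp
  | cons x l ih =>
    simp only [List.foldl_cons, List.mem_cons, exists_eq_or_imp]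
    rcases ih (max b (q x)) with h | h
    · rw [h]; rcases max_choice b (q x) with h' | h' <;> simp [h']
    · exact Or.inr (Or.inr h)

section DistanceGenerators

variable {X : Type*} [MetricSpace X]

/-- The unit and the normalized distance functions to the points of a sequence. -/
noncomputable def distGen (point : ℕ → X) (D : ℕ) (n : ℕ) (x : X) : ℝ :=
  n.casesOn 1 fun n => dist x (point n) / D

theorem continuous_distGen (point : ℕ → X) (D n : ℕ) : Continuous (distGen point D n) := by
  cases n with
  | zero => exact continuous_const
  | succ n => exact (continuous_id.dist continuous_const).div_const _

noncomputable def distGenMap (point : ℕ → X) (D n : ℕ) : C(X, ℂ) :=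
  ⟨fun x => (distGen point D n x : ℂ), Complex.continuous_ofReal.comp (continuous_distGen _ _ _)⟩

theorem dense_adjoin_distGenMap [CompactSpace X] {point : ℕ → X} (hp : DenseRange point) {D : ℕ}
    (hD : 0 < D) :
    Dense (NonUnitalStarAlgebra.adjoin ℂ (Set.range (distGenMap point D)) : Set C(X, ℂ)) := by
  set S := NonUnitalStarAlgebra.adjoin ℂ (Set.range (distGenMap point D))
  have hmem (n : ℕ) : distGenMap point D n ∈ S :=
    NonUnitalStarAlgebra.subset_adjoin ℂ _ ⟨n, rfl⟩
  have h1 : (1 : C(X, ℂ)) ∈ S := by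
    convert hmem 0
    ext x
    simp [distGenMap, distGen]
  have hsep : (S.toStarSubalgebra h1).SeparatesPoints := by
    intro x y hxy
    by_contra! hcon
    have hdist (n : ℕ) : dist x (point n) = dist y (point n) := by
      have := hcon (distGenMap point D (n + 1)) ⟨_, hmem (n + 1), rfl⟩
      have h2 : dist x (point n) / D = dist y (point n) / D :=
        Complex.ofReal_injective this
      have hD' : (D : ℝ) ≠ 0 := by positivity
      field_simp at h2
      exact h2
    have hall : (fun z => dist x z) = fun z => dist y z :=
      hp.equalizer (by fun_prop) (by fun_prop) (funext hdist)
    exact hxy (dist_eq_zero.1 ((congrFun hall y).trans (dist_self y)))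
  have := ContinuousMap.starSubalgebra_topologicalClosure_eq_top_of_separatesPoints _ hsep
  have h2 : (((S.toStarSubalgebra h1).topologicalClosure : StarSubalgebra ℂ C(X, ℂ)) :
      Set C(X, ℂ)) = Set.univ := by rw [this]; rfl
  rw [StarSubalgebra.topologicalClosure_coe] at h2
  exact dense_iff_closure_eq.2 h2

theorem eval_distGenMap_apply [CompactSpace X] (point : ℕ → X) (D : ℕ) (p : RatStarPoly) (x : X) :
    (p.eval (distGenMap point D)) x = p.eval fun n => (distGen point D n x : ℂ) :=
  (RatStarPoly.eval_map (ContinuousMap.evalStarAlgHom ℂ ℂ x) (distGenMap point D) p).symm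

end DistanceGenerators

theorem RatCode.val_div (q : RatCode) {D : ℕ} (hD : 0 < D) :
    RatCode.val (q.1, q.2.1, (q.2.2 + 1) * D - 1) = q.val / D := by
  have h : (((q.2.2 + 1) * D - 1 : ℕ) : ℚ) + 1 = (q.2.2 + 1) * D := by
    have : 0 < (q.2.2 + 1) * D := by positivity
    rw [Nat.cast_sub (by omega)]; push_cast; ring
  simp only [RatCode.val, h]
  field_simp

theorem RatCode.val_div_two_pow (n k : ℕ) : ((RatCode.val (n, 0, 2 ^ k - 1) : ℚ) : ℝ) =
    n / 2 ^ k := by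
  simp [RatCode.val]

/-- A rational approximation of the value of a generator at a point of the dense sequence. -/
def distGenCode (f : ℕ × ℕ × ℕ → RatCode) (D : ℕ) (a : (ℕ × ℕ) × ℕ) : RatCode :=
  a.2.casesOn (1, 0, 0) fun n =>
    ((f (a.1.1, n, a.1.2)).1, (f (a.1.1, n, a.1.2)).2.1, ((f (a.1.1, n, a.1.2)).2.2 + 1) * D - 1)

theorem computable_distGenCode {f : ℕ × ℕ × ℕ → RatCode} (hf : Computable f) (D : ℕ) :
    Computable (distGenCode f D) := by
  unfold distGenCode
  exact computable_natCases (by fun_prop) (by fun_prop) (by fun_prop)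

theorem computablyPresentable_of_metricSpace {X : Type*} [MetricSpace X] [CompactSpace X]
    {point : ℕ → X} (hp : DenseRange point) {f : ℕ × ℕ × ℕ → RatCode} (hf : Computable f)
    (hfd : ∀ m n k : ℕ, |((f (m, n, k)).val : ℝ) - dist (point m) (point n)| < (1 / 2 : ℝ) ^ k)
    {g : ℕ → List ℕ} (hg : Computable g)
    (hgc : ∀ (k : ℕ) (x : X), ∃ n ∈ g k, dist x (point n) < (1 / 2 : ℝ) ^ k) :
    ComputablyPresentable C(X, ℂ) := by
  obtain ⟨D, hD1, hD⟩ : ∃ D : ℕ, 1 ≤ D ∧ ∀ x y : X, dist x y / D ≤ 1 / 2 := by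
    obtain ⟨D, hD⟩ := exists_nat_ge (2 * Metric.diam (Set.univ : Set X))
    refine ⟨D + 1, by omega, fun x y => ?_⟩
    have := Metric.dist_le_diam_of_mem (isCompact_univ (X := X)).isBounded (Set.mem_univ x)
      (Set.mem_univ y)
    rw [div_le_iff₀ (by positivity)]
    push_cast
    linarith
  have hDr : (1 : ℝ) ≤ D := by exact_mod_cast hD1
  have hu := computable_distGenCode hf D
  let K : RatStarPoly × ℕ → ℕ := fun a => a.2 + lipBound a.1 + 4
  let q : (RatStarPoly × ℕ) → ℕ → ℕ := fun a j =>
    (evalCode (fun n => distGenCode f D ((j, K a), n)) a.1).scaledNorm (a.2 + 3)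
  let R : RatStarPoly × ℕ → ℕ := fun a => (g (K a)).foldl (fun acc j => max acc (q a j)) 0
  have hK : Computable K := by fun_prop
  have hR : Computable R := by
    have h1 : Computable fun b : (RatStarPoly × ℕ) × ℕ =>
        evalCode (fun n => distGenCode f D ((b.2, K b.1), n)) b.1.1 :=
      computable_evalCode (u := fun c : ((RatStarPoly × ℕ) × ℕ) × ℕ =>
        distGenCode f D ((c.1.2, K c.1.1), c.2)) (by fun_prop) (by fun_prop)
    have h2 : Computable fun b : (RatStarPoly × ℕ) × ℕ => q b.1 b.2 := by fun_prop
    have h3 : Computable fun b : (RatStarPoly × ℕ) × ℕ × ℕ => q b.1 b.2.2 :=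
      h2.comp (g := fun b : (RatStarPoly × ℕ) × ℕ × ℕ => (b.1, b.2.2)) (by fun_prop)
    exact computable_foldl (by fun_prop) (by fun_prop) (by fun_prop)
  refine ⟨⟨distGenMap point D, dense_adjoin_distGenMap hp (by omega)⟩,
    fun a => (R a, 0, 2 ^ (a.2 + 3) - 1), by fun_prop, fun p k => ?_⟩
  rw [RatCode.val_div_two_pow]
  have hgen1 (n : ℕ) (x : X) : ‖(distGen point D n x : ℂ)‖ ≤ 1 := by
    rw [Complex.norm_real, Real.norm_eq_abs]
    cases n with
    | zero => simp [distGen]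
    | succ n =>
      have := hD x (point n)
      rw [distGen, abs_of_nonneg (by positivity)]
      linarith
  have hε (n j : ℕ) : |((distGenCode f D ((j, K (p, k)), n)).val : ℝ) -
      distGen point D n (point j)| ≤ (1 / 2) ^ K (p, k) := by
    cases n with
    | zero => simp [distGenCode, distGen, RatCode.val]
    | succ n =>
      have h1 : distGenCode f D ((j, K (p, k)), n + 1) = ((f (j, n, K (p, k))).1,
        (f (j, n, K (p, k))).2.1, ((f (j, n, K (p, k))).2.2 + 1) * D - 1) := rfl
      have h2 := (hfd j n (K (p, k))).le
      rw [h1, RatCode.val_div _ (by omega)]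
      push_cast
      rw [distGen, ← sub_div, abs_div, abs_of_pos (by positivity : (0 : ℝ) < D)]
      exact (div_le_self (abs_nonneg _) hDr).trans h2
  have hhalf : ((1 : ℝ) / 2) ^ K (p, k) ≤ 1 / 2 := by
    have : ((1 : ℝ) / 2) ^ K (p, k) ≤ (1 / 2) ^ 1 :=
      pow_le_pow_of_le_one (by norm_num) (by norm_num) (by simp [K])
    simpa using this
  have hcode1 (n j : ℕ) :
      ‖((((distGenCode f D ((j, K (p, k)), n)).val : ℚ) : ℝ) : ℂ)‖ ≤ 1 := by
    rw [Complex.norm_real, Real.norm_eq_abs]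
    cases n with
    | zero => simp [distGenCode, RatCode.val]
    | succ n =>
      have h1 := abs_le.1 (hε (n + 1) j)
      have h2 := hD (point j) (point n)
      have h3 : 0 ≤ dist (point j) (point n) / D := by positivity
      simp only [distGen] at h1
      rw [abs_le]
      constructor <;> linarith
  have hLip : (lipBound p : ℝ) * (2 * (1 / 2) ^ K (p, k)) ≤ (1 / 2) ^ (k + 3) := by
    have h1 : (lipBound p : ℝ) ≤ 2 ^ lipBound p := by exact_mod_cast Nat.lt_two_pow_self.le
    calc (lipBound p : ℝ) * (2 * (1 / 2) ^ K (p, k))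
        ≤ 2 ^ lipBound p * (2 * (1 / 2) ^ K (p, k)) := by gcongr
      _ = (2 ^ lipBound p * (1 / 2) ^ lipBound p) * (1 / 2) ^ (k + 3) := by
          simp only [K]; ring
      _ = (1 / 2) ^ (k + 3) := by rw [← mul_pow]; norm_num
  have hclose (j : ℕ) (x : X) (hx : dist x (point j) ≤ (1 / 2) ^ K (p, k)) :
      |‖(evalCode (fun n => distGenCode f D ((j, K (p, k)), n)) p).val‖ -
        ‖(p.eval (distGenMap point D)) x‖| ≤ (1 / 2) ^ (k + 3) := by
    refine (abs_norm_sub_norm_le _ _).trans (le_trans ?_ hLip)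
    rw [eval_distGenMap_apply, val_evalCode]
    refine norm_eval_sub_eval_le (fun n => hcode1 n j) (fun n => hgen1 n x) (fun n => ?_) p
    rw [← Complex.ofReal_sub, Complex.norm_real, Real.norm_eq_abs]
    have h1 := hε n j
    have h2 : |distGen point D n (point j) - distGen point D n x| ≤ (1 / 2) ^ K (p, k) := by
      cases n with
      | zero => simp [distGen]
      | succ n =>
        simp only [distGen]
        rw [← sub_div, abs_div, abs_of_pos (by positivity : (0 : ℝ) < D)]
        refine (div_le_self (abs_nonneg _) hDr).trans ((abs_dist_sub_le _ _ _).trans ?_)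
        rwa [dist_comm]
    have := abs_sub_le (((distGenCode f D ((j, K (p, k)), n)).val : ℝ))
      (distGen point D n (point j)) (distGen point D n x)
    linarith
  have h2pos : (0 : ℝ) < 2 ^ (k + 3) := by positivity
  have hhp : ((1 : ℝ) / 2) ^ (k + 3) = 1 / 2 ^ (k + 3) := by rw [div_pow, one_pow]
  have hk : ((1 : ℝ) / 2) ^ k = 8 * (1 / 2) ^ (k + 3) := by rw [pow_add]; ring
  have hkpos : (0 : ℝ) < (1 / 2) ^ (k + 3) := by positivity
  set F := p.eval (distGenMap point D) with hF
  have hup : (R (p, k) : ℝ) / 2 ^ (k + 3) ≤ ‖F‖ + (1 / 2) ^ (k + 3) := by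
    rcases foldl_max_eq_or_exists (q (p, k)) (g (K (p, k))) 0 with h | ⟨j, -, h⟩
    · have : R (p, k) = 0 := h
      rw [this]; simp; positivity
    · have : R (p, k) = q (p, k) j := h
      rw [this, div_le_iff₀ h2pos]
      have h1 := (GaussCode.scaledNorm_le_and_lt
        (evalCode (fun n => distGenCode f D ((j, K (p, k)), n)) p) (k + 3)).1
      have h2 := (abs_le.1 (hclose j (point j) (by simp))).2
      have h3 := F.norm_coe_le_norm (point j)
      refine h1.trans ?_
      rw [mul_comm]
      gcongr
      linarith
  have hlow : ‖F‖ ≤ (R (p, k) : ℝ) / 2 ^ (k + 3) + 2 * (1 / 2) ^ (k + 3) := by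
    refine (ContinuousMap.norm_le _ (by positivity)).2 fun x => ?_
    obtain ⟨j, hj, hjx⟩ := hgc (K (p, k)) x
    have h1 := (GaussCode.scaledNorm_le_and_lt
      (evalCode (fun n => distGenCode f D ((j, K (p, k)), n)) p) (k + 3)).2
    have h2 := (abs_le.1 (hclose j x hjx.le)).1
    have h3 : ((q (p, k) j : ℕ) : ℝ) ≤ R (p, k) := by
      exact_mod_cast (le_foldl_max (q (p, k)) (g (K (p, k))) 0).2 j hj
    have h4 : ‖(evalCode (fun n => distGenCode f D ((j, K (p, k)), n)) p).val‖ ≤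
        (R (p, k) : ℝ) / 2 ^ (k + 3) + (1 / 2) ^ (k + 3) := by
      rw [hhp, ← add_div, le_div_iff₀ h2pos, mul_comm]
      exact h1.le.trans (by simpa [q] using h3)
    linarith
  rw [abs_lt]
  constructor <;> linarith

theorem HasComputablyCompactPresentation.computablyPresentable {X : Type*} [t : TopologicalSpace X]
    [CompactSpace X] (h : HasComputablyCompactPresentation X) : ComputablyPresentable C(X, ℂ) := by
  obtain ⟨⟨metric, compatible, complete, point, hp, f, hf, hfd⟩, g, hg, hgc⟩ := h
  subst compatible
  exact computablyPresentable_of_metricSpace hp hf hfd hg hgc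

section GridCodes

/-- The `i`-th digit of `c` in base `4 ^ s + 1`. -/
def gridDigit (s c i : ℕ) : ℕ := c / (4 ^ s + 1) ^ i % (4 ^ s + 1)

@[fun_prop]
theorem computable_gridDigit {α : Type*} [Primcodable α] {f g k : α → ℕ} (hf : Computable f)
    (hg : Computable g) (hk : Computable k) : Computable fun a => gridDigit (f a) (g a) (k a) := by
  unfold gridDigit; fun_prop

theorem exists_digits (B n : ℕ) (d : ℕ → ℕ) (hd : ∀ i < n, d i < B) :
    ∃ c < B ^ n, ∀ i < n, c / B ^ i % B = d i := by
  induction n with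
  | zero => exact ⟨0, by simp, by simp⟩
  | succ n ih =>
    obtain ⟨c, hc, hci⟩ := ih fun i hi => hd i (by omega)
    have hdn := hd n (by omega)
    have hB : 0 < B := by omega
    refine ⟨c + B ^ n * d n, ?_, fun i hi => ?_⟩
    · calc c + B ^ n * d n < B ^ n + B ^ n * d n := by omega
        _ = B ^ n * (d n + 1) := by ring
        _ ≤ B ^ n * B := Nat.mul_le_mul_left _ hdn
        _ = B ^ (n + 1) := (pow_succ _ _).symm
    · rcases Nat.lt_succ_iff_lt_or_eq.1 hi with h | rfl
      · obtain ⟨e, rfl⟩ : ∃ e, n = i + 1 + e := ⟨n - (i + 1), by omega⟩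
        have h1 : B ^ (i + 1 + e) * d (i + 1 + e) = B ^ i * (B * (B ^ e * d (i + 1 + e))) := by
          ring
        rw [h1, Nat.add_mul_div_left _ _ (by positivity), Nat.add_mul_mod_self_left, hci i h]
      · rw [Nat.add_mul_div_left _ _ (by positivity), Nat.div_eq_of_lt hc, zero_add,
          Nat.mod_eq_of_lt hdn]

theorem exists_gridCode (y : ℕ → ℝ) (hy0 : ∀ i, 0 ≤ y i) (hy1 : ∀ i, y i ≤ 1) (s : ℕ) :
    ∃ c < (4 ^ s + 1) ^ s, ∀ i < s, |y i - gridDigit s c i / 4 ^ s| ≤ 1 / 4 ^ s := by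
  have h4 : (0 : ℝ) < 4 ^ s := by positivity
  obtain ⟨c, hc, hci⟩ := exists_digits (4 ^ s + 1) s (fun i => ⌊y i * 4 ^ s⌋₊) fun i _ => by
    rw [Nat.lt_succ_iff]
    refine Nat.floor_le_of_le ?_
    push_cast
    exact mul_le_of_le_one_left h4.le (hy1 i)
  refine ⟨c, hc, fun i hi => ?_⟩
  have h1 : gridDigit s c i = ⌊y i * 4 ^ s⌋₊ := hci i hi
  have h2 := Nat.floor_le (a := y i * 4 ^ s) (mul_nonneg (hy0 i) h4.le)
  have h3 := Nat.lt_floor_add_one (y i * 4 ^ s)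
  have h5 : y i - gridDigit s c i / 4 ^ s = (y i * 4 ^ s - ⌊y i * 4 ^ s⌋₊) / 4 ^ s := by
    rw [h1]; field_simp
  rw [h5, abs_div, abs_of_pos h4]
  gcongr
  rw [abs_le]; constructor <;> linarith

end GridCodes

theorem abs_sub_add_nat (m n : ℕ) : (((m - n) + (n - m) : ℕ) : ℝ) = |(m : ℝ) - n| := by
  rcases le_total m n with h | h
  · rw [Nat.sub_eq_zero_of_le h, zero_add, Nat.cast_sub h, abs_sub_comm, abs_of_nonneg]
    simpa using h
  · rw [Nat.sub_eq_zero_of_le h, add_zero, Nat.cast_sub h, abs_of_nonneg]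
    simpa using h

theorem four_inv_pow_le (s : ℕ) : (1 : ℝ) / 4 ^ s ≤ (1 / 2) ^ s := by
  rw [div_pow, one_pow]
  gcongr
  norm_num

theorem mul_half_pow_lt {s k : ℕ} (h : 2 * k + 8 ≤ s) :
    (12 * s + 2 : ℝ) * (1 / 2) ^ s < (1 / 2) ^ k := by
  obtain ⟨e, rfl⟩ : ∃ e, s = 2 * k + 8 + e := ⟨s - (2 * k + 8), by omega⟩
  have h1 : k + e < 2 ^ (k + e) := Nat.lt_two_pow_self
  have h2 : 12 * (2 * k + 8 + e) + 2 < 2 ^ (k + 8 + e) := by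
    have : 2 ^ (k + 8 + e) = 256 * 2 ^ (k + e) := by ring
    omega
  have h3 : (12 * ((2 * k + 8 + e : ℕ) : ℝ) + 2) < 2 ^ (k + 8 + e) := by exact_mod_cast h2
  calc (12 * ((2 * k + 8 + e : ℕ) : ℝ) + 2) * (1 / 2) ^ (2 * k + 8 + e)
      < 2 ^ (k + 8 + e) * (1 / 2) ^ (2 * k + 8 + e) := by gcongr
    _ = (2 ^ (k + 8 + e) * (1 / 2) ^ (k + 8 + e)) * (1 / 2) ^ k := by ring
    _ = (1 / 2) ^ k := by rw [← mul_pow]; norm_num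

theorem abs_tsum_min_sub_sum_le {t : ℕ → ℝ} (ht : ∀ i, 0 ≤ t i) (n : ℕ) :
    |∑' i, min ((2 : ℝ)⁻¹ ^ i) (t i) - ∑ i ∈ Finset.range n, min ((2 : ℝ)⁻¹ ^ i) (t i)| ≤
      2 * (1 / 2) ^ n := by
  have h0 (i : ℕ) : 0 ≤ min ((2 : ℝ)⁻¹ ^ i) (t i) := le_min (by positivity) (ht i)
  have hg : Summable fun i : ℕ => (2 : ℝ)⁻¹ ^ i := by
    simpa using summable_geometric_two
  have hs : Summable fun i => min ((2 : ℝ)⁻¹ ^ i) (t i) :=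
    hg.of_nonneg_of_le h0 fun i => min_le_left _ _
  rw [← hs.sum_add_tsum_nat_add n, add_sub_cancel_left, abs_of_nonneg (tsum_nonneg fun i => h0 _)]
  calc ∑' i, min ((2 : ℝ)⁻¹ ^ (i + n)) (t (i + n))
      ≤ ∑' i, (2 : ℝ)⁻¹ ^ (i + n) :=
        ((summable_nat_add_iff n).2 hs).tsum_le_tsum (fun i => min_le_left _ _)
          ((summable_nat_add_iff n).2 hg)
    _ = 2 * (1 / 2) ^ n := by
        simp_rw [pow_add, tsum_mul_right]
        rw [tsum_geometric_inv_two, one_div]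

theorem exists_limit_point {X : Type*} [TopologicalSpace X] [CompactSpace X] {h : ℕ → X → ℝ}
    (hc : ∀ i, Continuous (h i)) {a : ℕ → ℕ → ℝ} {s₀ : ℕ}
    (hx : ∀ s ≥ s₀, ∃ x, ∀ i < s, |h i x - a s i| ≤ 2 * (1 / 2) ^ s)
    (ha : ∀ s ≥ s₀, ∀ i < s, |a s i - a (s + 1) i| ≤ 3 * (1 / 2) ^ s) :
    ∃ x, ∀ s ≥ s₀, ∀ i < s, |h i x - a s i| ≤ 6 * (1 / 2) ^ s := by
  have htel (s : ℕ) (hs : s₀ ≤ s) (i : ℕ) (hi : i < s) (u : ℕ) (hu : s ≤ u) :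
      |a s i - a u i| ≤ 6 * (1 / 2) ^ s - 6 * (1 / 2) ^ u := by
    induction u, hu using Nat.le_induction with
    | base => simp
    | succ u hu ih =>
      have h1 := ha u (by omega) i (by omega)
      have h2 := abs_sub_le (a s i) (a u i) (a (u + 1) i)
      rw [pow_succ]
      linarith
  let C : ℕ → Set X := fun n => {x | ∀ s ≥ s₀, s ≤ s₀ + n → ∀ i < s, |h i x - a s i| ≤
    6 * (1 / 2) ^ s}
  have hC : IsClosed (C 0) ∧ ∀ n, IsClosed (C n) := by
    have : ∀ n, IsClosed (C n) := by
      intro n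
      simp only [C, Set.ofPred_forall]
      refine isClosed_iInter fun s => isClosed_iInter fun _ => isClosed_iInter fun _ =>
        isClosed_iInter fun i => isClosed_iInter fun _ => ?_
      have := hc i
      exact isClosed_le (by fun_prop) continuous_const
    exact ⟨this 0, this⟩
  obtain ⟨x, hxC⟩ := IsCompact.nonempty_iInter_of_sequence_nonempty_isCompact_isClosed C
    (fun n x hx s hs hsn => hx s hs (by omega))
    (fun n => by
      obtain ⟨x, hx⟩ := hx (s₀ + n) (by omega)
      refine ⟨x, fun s hs hsn i hi => ?_⟩
      have h1 := hx i (by omega)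
      have h2 := htel s hs i hi (s₀ + n) hsn
      have h3 := abs_sub_le (h i x) (a (s₀ + n) i) (a s i)
      rw [abs_sub_comm (a (s₀ + n) i)] at h3
      have h4 : (0 : ℝ) < (1 / 2) ^ (s₀ + n) := by positivity
      linarith)
    hC.1.isCompact hC.2
  rw [Set.mem_iInter] at hxC
  exact ⟨x, fun s hs i hi => hxC s s hs (by omega) i hi⟩

/-- Closeness of the grid points coded by `c` and `c'` at two consecutive levels. -/
def gridClose (s c c' : ℕ) : Bool :=
  (List.range s).all fun i => decide ((4 * gridDigit s c i - gridDigit (s + 1) c' i) +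
    (gridDigit (s + 1) c' i - 4 * gridDigit s c i) < 12 * 2 ^ s)

@[fun_prop]
theorem computable_gridClose {α : Type*} [Primcodable α] {f g k : α → ℕ} (hf : Computable f)
    (hg : Computable g) (hk : Computable k) : Computable fun a => gridClose (f a) (g a) (k a) := by
  unfold gridClose; fun_prop

theorem gridClose_iff (s c c' : ℕ) : gridClose s c c' = true ↔ ∀ i < s,
    |(gridDigit s c i / 4 ^ s : ℝ) - gridDigit (s + 1) c' i / 4 ^ (s + 1)| < 3 * (1 / 2) ^ s := by
  simp only [gridClose, List.all_eq_true, List.mem_range, decide_eq_true_eq]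
  refine forall₂_congr fun i _ => ?_
  have e7 : (gridDigit s c i / 4 ^ s : ℝ) - gridDigit (s + 1) c' i / 4 ^ (s + 1) =
      ((4 * gridDigit s c i : ℕ) - (gridDigit (s + 1) c' i : ℕ)) / 4 ^ (s + 1) := by
    push_cast; rw [pow_succ]; field_simp
  have e8 : 3 * (1 / 2 : ℝ) ^ s * 4 ^ (s + 1) = (12 * 2 ^ s : ℕ) := by
    have : (4 : ℝ) ^ s = 2 ^ s * 2 ^ s := by rw [← mul_pow]; norm_num
    push_cast
    rw [pow_succ, this, div_pow, one_pow]
    field_simp; norm_num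
  rw [e7, abs_div, abs_of_pos (by positivity : (0 : ℝ) < 4 ^ (s + 1)),
    div_lt_iff₀ (by positivity), ← abs_sub_add_nat, e8, Nat.cast_lt]

section Points

variable {X : Type*} {h : ℕ → X → ℝ} {test : ℕ × ℕ → Bool}

theorem exists_start [Nonempty X] (h0 : ∀ i x, 0 ≤ h i x) (h1 : ∀ i x, h i x ≤ 1)
    (htest : Computable test)
    (hcomplete : ∀ s c x, (∀ i < s, |h i x - gridDigit s c i / 4 ^ s| ≤ 1 / 4 ^ s) →
      test (s, c) = true) :
    ∃ start : ℕ × ℕ → ℕ, Computable start ∧ ∀ s c, test (s, start (s, c)) = true ∧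
      (test (s, c) = true → start (s, c) = c) := by
  obtain ⟨start, hstart, hstart'⟩ := exists_computable_search (α := ℕ × ℕ)
    (P := fun a c => test (a.1, c) && (decide (c = a.2) || !test a)) (by fun_prop) (by
      rintro ⟨s, c⟩
      by_cases hsc : test (s, c) = true
      · exact ⟨c, by simp [hsc]⟩
      · obtain ⟨c', -, hc'⟩ := exists_gridCode (fun i => h i (Classical.arbitrary X))
          (fun i => h0 i _) (fun i => h1 i _) s
        exact ⟨c', by simp [hsc, hcomplete s c' _ hc']⟩)
  refine ⟨start, hstart, fun s c => ?_⟩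
  have := hstart' (s, c)
  rw [Bool.and_eq_true] at this
  exact ⟨this.1, fun hsc => by simpa [hsc] using this.2⟩

theorem exists_next (h0 : ∀ i x, 0 ≤ h i x) (h1 : ∀ i x, h i x ≤ 1) (htest : Computable test)
    (hsound : ∀ s c, test (s, c) = true →
      ∃ x, ∀ i < s, |h i x - gridDigit s c i / 4 ^ s| ≤ 2 * (1 / 2) ^ s)
    (hcomplete : ∀ s c x, (∀ i < s, |h i x - gridDigit s c i / 4 ^ s| ≤ 1 / 4 ^ s) →
      test (s, c) = true) :
    ∃ next : ℕ × ℕ → ℕ, Computable next ∧ ∀ s c, test (s, c) = true →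
      test (s + 1, next (s, c)) = true ∧ gridClose s c (next (s, c)) = true := by
  obtain ⟨next, hnext, hnext'⟩ := exists_computable_search (α := ℕ × ℕ)
    (P := fun a c' => (!test a) || (test (a.1 + 1, c') && gridClose a.1 a.2 c'))
    (by fun_prop) (by
      rintro ⟨s, c⟩
      by_cases hsc : test (s, c) = true
      · obtain ⟨x, hx⟩ := hsound s c hsc
        obtain ⟨c', -, hc'⟩ := exists_gridCode (fun i => h i x)
          (fun i => h0 i _) (fun i => h1 i _) (s + 1)
        refine ⟨c', ?_⟩
        have hcl : gridClose s c c' = true := by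
          refine (gridClose_iff s c c').2 fun i hi => ?_
          have e1 := hx i hi
          have e2 := hc' i (by omega)
          have e3 := abs_sub_le (gridDigit s c i / 4 ^ s : ℝ) (h i x)
            (gridDigit (s + 1) c' i / 4 ^ (s + 1))
          rw [abs_sub_comm (gridDigit s c i / 4 ^ s : ℝ) (h i x)] at e3
          have e4 := four_inv_pow_le (s + 1)
          have e5 : (0 : ℝ) < (1 / 2) ^ s := by positivity
          rw [pow_succ (1 / 2 : ℝ)] at e4
          linarith
        simp [hcomplete (s + 1) c' x hc', hcl]
      · exact ⟨0, by simp [hsc]⟩)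
  refine ⟨next, hnext, fun s c hsc => ?_⟩
  simpa [hsc] using hnext' (s, c)

theorem exists_computable_points [TopologicalSpace X] [CompactSpace X] [Nonempty X]
    (hc : ∀ i, Continuous (h i)) (h0 : ∀ i x, 0 ≤ h i x) (h1 : ∀ i x, h i x ≤ 1)
    (htest : Computable test)
    (hsound : ∀ s c, test (s, c) = true →
      ∃ x, ∀ i < s, |h i x - gridDigit s c i / 4 ^ s| ≤ 2 * (1 / 2) ^ s)
    (hcomplete : ∀ s c x, (∀ i < s, |h i x - gridDigit s c i / 4 ^ s| ≤ 1 / 4 ^ s) →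
      test (s, c) = true) :
    ∃ (pt : ℕ → X) (D : ℕ × ℕ × ℕ → ℕ), Computable D ∧
      (∀ j s, (Nat.unpair j).1 ≤ s → ∀ i < s,
        |h i (pt j) - D (j, s, i) / 4 ^ s| ≤ 6 * (1 / 2) ^ s) ∧
      ∀ s c i, test (s, c) = true → D (Nat.pair s c, s, i) = gridDigit s c i := by
  obtain ⟨start, hstart, hstart'⟩ := exists_start h0 h1 htest hcomplete
  obtain ⟨next, hnext, hnext'⟩ := exists_next h0 h1 htest hsound hcomplete
  obtain ⟨chain, hchain, hchain_zero, hchain_succ⟩ : ∃ chain : ℕ × ℕ → ℕ, Computable chain ∧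
      (∀ j, chain (j, 0) = start (Nat.unpair j)) ∧
      ∀ j t, chain (j, t + 1) = next ((Nat.unpair j).1 + t, chain (j, t)) :=
    ⟨fun a => Nat.rec (start (Nat.unpair a.1)) (fun t c => next ((Nat.unpair a.1).1 + t, c)) a.2,
      computable_natRec (g := fun a : ℕ × ℕ => start (Nat.unpair a.1))
        (h := fun a t c => next ((Nat.unpair a.1).1 + t, c)) (by fun_prop) (by fun_prop)
        (by fun_prop), fun _ => rfl, fun _ _ => rfl⟩
  have hchain_test (j t : ℕ) : test ((Nat.unpair j).1 + t, chain (j, t)) = true := by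
    induction t with
    | zero =>
      rw [hchain_zero]
      exact (hstart' (Nat.unpair j).1 (Nat.unpair j).2).1
    | succ t ih =>
      rw [hchain_succ]
      exact (hnext' _ _ ih).1
  have hpt (j : ℕ) : ∃ x, ∀ s ≥ (Nat.unpair j).1, ∀ i < s,
      |h i x - gridDigit s (chain (j, s - (Nat.unpair j).1)) i / 4 ^ s| ≤ 6 * (1 / 2) ^ s := by
    refine exists_limit_point hc
      (a := fun s i => gridDigit s (chain (j, s - (Nat.unpair j).1)) i / 4 ^ s) (fun s hs => ?_)
      (fun s hs i hi => ?_)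
    · refine hsound s _ ?_
      have := hchain_test j (s - (Nat.unpair j).1)
      rwa [Nat.add_sub_cancel' hs] at this
    · have e1 := hchain_test j (s - (Nat.unpair j).1)
      rw [Nat.add_sub_cancel' hs] at e1
      have e2 := (gridClose_iff _ _ _).1 (hnext' _ _ e1).2 i hi
      have e0 : chain (j, s + 1 - (Nat.unpair j).1) =
          next (s, chain (j, s - (Nat.unpair j).1)) := by
        rw [Nat.succ_sub hs, hchain_succ, Nat.add_sub_cancel' hs]
      simp only [e0]
      exact e2.le
  choose pt hpt using hpt
  refine ⟨pt, fun a => gridDigit a.2.1 (chain (a.1, a.2.1 - (Nat.unpair a.1).1)) a.2.2,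
    by fun_prop, hpt, fun s c i hsc => ?_⟩
  simp only [Nat.unpair_pair, Nat.sub_self, hchain_zero, (hstart' s c).2 hsc]

end Points

section Metric

variable {X : Type*} {h : ℕ → X → ℝ}

/-- The metric pulled back from the Hilbert cube along a separating sequence of functions. -/
noncomputable abbrev cubeMetric (h : ℕ → X → ℝ) (hsep : ∀ x y, (∀ i, h i x = h i y) → x = y) :
    MetricSpace X :=
  MetricSpace.induced (fun x i => h i x) (fun x y hxy => hsep x y (congrFun hxy))
    (PiCountable.metricSpace (F := fun _ : ℕ => ℝ))

theorem cubeMetric_dist (hsep : ∀ x y, (∀ i, h i x = h i y) → x = y) (x y : X) :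
    (cubeMetric h hsep).dist x y = ∑' i : ℕ, min ((2 : ℝ)⁻¹ ^ i) |h i x - h i y| := rfl

theorem cubeMetric_compatible [t : TopologicalSpace X] [CompactSpace X]
    (hc : ∀ i, Continuous (h i)) (hsep : ∀ x y, (∀ i, h i x = h i y) → x = y) :
    (cubeMetric h hsep).toPseudoMetricSpace.toUniformSpace.toTopologicalSpace = t := by
  have hHe : Topology.IsClosedEmbedding fun x i => h i x :=
    (continuous_pi hc).isClosedEmbedding fun x y hxy => hsep x y (congrFun hxy)
  exact hHe.eq_induced.symm

theorem cubeMetric_dist_lt (hsep : ∀ x y, (∀ i, h i x = h i y) → x = y) {s k : ℕ}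
    (hs : 2 * k + 8 ≤ s) {x y : X} (hxy : ∀ i < s, |h i x - h i y| ≤ 7 * (1 / 2) ^ s) :
    (cubeMetric h hsep).dist x y < (1 / 2) ^ k := by
  refine lt_of_le_of_lt ?_ (mul_half_pow_lt hs)
  have e1 := (abs_le.1 (abs_tsum_min_sub_sum_le (t := fun i => |h i x - h i y|)
    (fun i => abs_nonneg _) s)).2
  have e2 : ∑ i ∈ Finset.range s, min ((2 : ℝ)⁻¹ ^ i) |h i x - h i y| ≤
      ∑ i ∈ Finset.range s, 7 * (1 / 2 : ℝ) ^ s :=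
    Finset.sum_le_sum fun i hi => (min_le_right _ _).trans (hxy i (Finset.mem_range.1 hi))
  rw [Finset.sum_const, Finset.card_range, nsmul_eq_mul] at e2
  rw [cubeMetric_dist]
  have e3 : (0 : ℝ) ≤ s * (1 / 2) ^ s := by positivity
  linarith

/-- The numerator of the distance of two grid points at level `s`, with denominator `4 ^ s`. -/
def gridDist (D : ℕ × ℕ × ℕ → ℕ) (s j j' : ℕ) : ℕ :=
  ((List.range s).map fun i => min (2 ^ (2 * s - i)) ((D (j, s, i) - D (j', s, i)) +
    (D (j', s, i) - D (j, s, i)))).sum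

theorem gridDist_div (D : ℕ × ℕ × ℕ → ℕ) (s j j' : ℕ) :
    (gridDist D s j j' : ℝ) / 2 ^ (2 * s) = ∑ i ∈ Finset.range s,
      min ((2 : ℝ)⁻¹ ^ i) |(D (j, s, i) : ℝ) / 4 ^ s - D (j', s, i) / 4 ^ s| := by
  have h4 : (4 : ℝ) ^ s = 2 ^ (2 * s) := by rw [pow_mul]; norm_num
  have : gridDist D s j j' = ∑ i ∈ Finset.range s, min (2 ^ (2 * s - i))
      ((D (j, s, i) - D (j', s, i)) + (D (j', s, i) - D (j, s, i))) := rfl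
  rw [this, Nat.cast_sum, Finset.sum_div]
  refine Finset.sum_congr rfl fun i hi => ?_
  have hi := Finset.mem_range.1 hi
  rw [Nat.cast_min, abs_sub_add_nat, ← sub_div, abs_div,
    abs_of_pos (by positivity : (0 : ℝ) < 4 ^ s), h4, ← min_div_div_right (by positivity)]
  congr 1
  push_cast
  rw [div_eq_iff (by positivity), ← pow_sub_mul_pow (2 : ℝ) (by omega : i ≤ 2 * s),
    mul_left_comm, ← mul_pow]
  norm_num

theorem abs_gridDist_sub_lt (hsep : ∀ x y, (∀ i, h i x = h i y) → x = y)
    {D : ℕ × ℕ × ℕ → ℕ} {s j j' k : ℕ} (hs : 2 * k + 8 ≤ s) {x y : X}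
    (hx : ∀ i < s, |h i x - D (j, s, i) / 4 ^ s| ≤ 6 * (1 / 2) ^ s)
    (hy : ∀ i < s, |h i y - D (j', s, i) / 4 ^ s| ≤ 6 * (1 / 2) ^ s) :
    |(gridDist D s j j' : ℝ) / 2 ^ (2 * s) - (cubeMetric h hsep).dist x y| < (1 / 2) ^ k := by
  refine lt_of_le_of_lt ?_ (mul_half_pow_lt hs)
  have e2 := abs_tsum_min_sub_sum_le (t := fun i => |h i x - h i y|) (fun i => abs_nonneg _) s
  rw [gridDist_div, cubeMetric_dist]
  have e3 : abs ((∑ i ∈ Finset.range s,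
        min ((2 : ℝ)⁻¹ ^ i) |(D (j, s, i) : ℝ) / 4 ^ s - D (j', s, i) / 4 ^ s|) -
      ∑ i ∈ Finset.range s, min ((2 : ℝ)⁻¹ ^ i) |h i x - h i y|) ≤
      ∑ i ∈ Finset.range s, 12 * (1 / 2 : ℝ) ^ s := by
    rw [← Finset.sum_sub_distrib]
    refine (Finset.abs_sum_le_sum_abs _ _).trans (Finset.sum_le_sum fun i hi => ?_)
    have hi := Finset.mem_range.1 hi
    refine (abs_min_sub_min_le_max _ _ _ _).trans ?_
    rw [sub_self, abs_zero, max_eq_right (abs_nonneg _)]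
    refine (abs_abs_sub_abs_le _ _).trans ?_
    have f1 := abs_le.1 (hx i hi)
    have f2 := abs_le.1 (hy i hi)
    rw [abs_le]
    constructor <;> linarith
  rw [Finset.sum_const, Finset.card_range, nsmul_eq_mul] at e3
  rw [abs_le] at e2 e3 ⊢
  constructor <;> linarith

end Metric

theorem hasComputablyCompactPresentation_of_test {X : Type*} [t : TopologicalSpace X]
    [CompactSpace X] [Nonempty X] {h : ℕ → X → ℝ} (hc : ∀ i, Continuous (h i))
    (h0 : ∀ i x, 0 ≤ h i x) (h1 : ∀ i x, h i x ≤ 1) (hsep : ∀ x y, (∀ i, h i x = h i y) → x = y)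
    {test : ℕ × ℕ → Bool} (htest : Computable test)
    (hsound : ∀ s c, test (s, c) = true →
      ∃ x, ∀ i < s, |h i x - gridDigit s c i / 4 ^ s| ≤ 2 * (1 / 2) ^ s)
    (hcomplete : ∀ s c x, (∀ i < s, |h i x - gridDigit s c i / 4 ^ s| ≤ 1 / 4 ^ s) →
      test (s, c) = true) : HasComputablyCompactPresentation X := by
  obtain ⟨pt, D, hDc, hpt, hcode⟩ := exists_computable_points hc h0 h1 htest hsound hcomplete
  have hmt := cubeMetric_compatible hc hsep
  let g : ℕ → List ℕ := fun k =>
    (List.range ((4 ^ (2 * k + 8) + 1) ^ (2 * k + 8))).map fun c => Nat.pair (2 * k + 8) c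
  have hg : Computable g := by fun_prop
  have hnet (k : ℕ) (x : X) :
      ∃ n ∈ g k, (cubeMetric h hsep).dist x (pt n) < (1 / 2 : ℝ) ^ k := by
    obtain ⟨c, hclt, hcx⟩ := exists_gridCode (fun i => h i x) (fun i => h0 i _) (fun i => h1 i _)
      (2 * k + 8)
    have hct := hcomplete _ c x hcx
    refine ⟨Nat.pair (2 * k + 8) c, List.mem_map.2 ⟨c, List.mem_range.2 hclt, rfl⟩, ?_⟩
    refine cubeMetric_dist_lt hsep (s := 2 * k + 8) le_rfl fun i hi => ?_
    have e1 := hpt (Nat.pair (2 * k + 8) c) (2 * k + 8) (by simp) i hi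
    rw [hcode _ _ _ hct] at e1
    have e3 := hcx i hi
    have e4 := four_inv_pow_le (2 * k + 8)
    have e5 := abs_sub_le (h i x) (gridDigit (2 * k + 8) c i / 4 ^ (2 * k + 8))
      (h i (pt (Nat.pair (2 * k + 8) c)))
    rw [abs_sub_comm (_ / _) (h i (pt _))] at e5
    linarith
  let lev : ℕ × ℕ × ℕ → ℕ := fun a => 2 * a.2.2 + 8 + (Nat.unpair a.1).1 + (Nat.unpair a.2.1).1
  have hlev : Computable lev := by fun_prop
  have hS : Computable fun a : ℕ × ℕ × ℕ => gridDist D (lev a) a.1 a.2.1 := by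
    unfold gridDist; fun_prop
  have hdense : DenseRange pt := by
    have : @DenseRange X (cubeMetric h hsep).toPseudoMetricSpace.toUniformSpace.toTopologicalSpace
        ℕ pt := by
      let _ := cubeMetric h hsep
      refine Metric.denseRange_iff.2 fun x r hr => ?_
      obtain ⟨k, hk⟩ := exists_pow_lt_of_lt_one hr (by norm_num : (1 / 2 : ℝ) < 1)
      obtain ⟨n, -, hn⟩ := hnet k x
      exact ⟨n, hn.trans hk⟩
    rwa [hmt] at this
  have hcomp : @CompleteSpace X (cubeMetric h hsep).toPseudoMetricSpace.toUniformSpace := by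
    have : @CompactSpace X
        (cubeMetric h hsep).toPseudoMetricSpace.toUniformSpace.toTopologicalSpace := by
      rw [hmt]; infer_instance
    let _ := cubeMetric h hsep
    exact complete_of_compact
  refine ⟨⟨cubeMetric h hsep, hmt, hcomp, pt, hdense,
    fun a => (gridDist D (lev a) a.1 a.2.1, 0, 2 ^ (2 * lev a) - 1), by fun_prop,
    fun j j' k => ?_⟩, g, hg, hnet⟩
  rw [RatCode.val_div_two_pow]
  exact abs_gridDist_sub_lt hsep (by simp only [lev]; omega)
    (hpt j _ (by simp only [lev]; omega)) (hpt j' _ (by simp only [lev]; omega))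

section SpectrumTest

/-- The real or the imaginary part of a generator with norm at most `B`, rescaled to `[0, 1]`. -/
noncomputable def coordFun {X : Type*} [TopologicalSpace X] (v : ℕ → C(X, ℂ)) (B : ℕ → ℕ) (n : ℕ) (x : X) : ℝ :=
  (1 + (bif decide (n % 2 = 0) then (v (n / 2) x).re else (v (n / 2) x).im) / B (n / 2)) / 2

theorem continuous_coordFun {X : Type*} [TopologicalSpace X] (v : ℕ → C(X, ℂ)) (B : ℕ → ℕ) (n : ℕ) :
    Continuous (coordFun v B n) := by
  unfold coordFun
  cases decide (n % 2 = 0) <;> simp only [cond_true, cond_false] <;> fun_prop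

variable {X : Type*} [TopologicalSpace X] [CompactSpace X]

theorem coordFun_mem_Icc {v : ℕ → C(X, ℂ)} {B : ℕ → ℕ} (hB0 : ∀ n, 0 < B n)
    (hB : ∀ n, ‖v n‖ ≤ B n) (n : ℕ) (x : X) : coordFun v B n x ∈ Set.Icc (0 : ℝ) 1 := by
  have h0 : (0 : ℝ) < B (n / 2) := by exact_mod_cast hB0 _
  have h1 : ‖v (n / 2) x‖ ≤ B (n / 2) := ((v (n / 2)).norm_coe_le_norm x).trans (hB _)
  have h2 : |(bif decide (n % 2 = 0) then (v (n / 2) x).re else (v (n / 2) x).im) / B (n / 2)| ≤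
      (1 : ℝ) := by
    rw [abs_div, abs_of_pos h0, div_le_one h0]
    refine le_trans ?_ h1
    cases decide (n % 2 = 0)
    · exact Complex.abs_im_le_norm _
    · exact Complex.abs_re_le_norm _
  rw [abs_le] at h2
  unfold coordFun
  constructor <;> linarith

theorem eq_of_coordFun_eq [T2Space X] (P : CStarPresentation C(X, ℂ)) {B : ℕ → ℕ}
    (hB0 : ∀ n, 0 < B n) {x y : X}
    (hxy : ∀ n, coordFun P.vec B n x = coordFun P.vec B n y) : x = y := by
  have hvec (n : ℕ) : P.vec n x = P.vec n y := by
    have h0 : (B n : ℝ) ≠ 0 := by exact_mod_cast (hB0 n).ne'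
    have hre := hxy (2 * n)
    have him := hxy (2 * n + 1)
    have e1 : (2 * n + 1) / 2 = n := by omega
    have e2 : (2 * n + 1) % 2 = 1 := by omega
    simp only [coordFun, Nat.mul_mod_right, decide_true, cond_true, e1, e2, one_ne_zero,
      decide_false, cond_false, Nat.mul_div_cancel_left n two_pos] at hre him
    field_simp at hre him
    apply Complex.ext <;> linarith
  have heval (x : X) (p : RatStarPoly) :
      (p.eval P.vec) x = p.eval fun n => P.vec n x :=
    (RatStarPoly.eval_map (ContinuousMap.evalStarAlgHom ℂ ℂ x) P.vec p).symm
  have hall : (fun F : C(X, ℂ) => F x) = fun F => F y := by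
    refine P.denseRange_eval.equalizer (continuous_eval_const x)
      (continuous_eval_const y) (funext fun p => ?_)
    simp only [Function.comp_apply, heval, hvec]
  by_contra hne
  obtain ⟨F, hFx, hFy, -⟩ := exists_continuous_zero_one_of_isClosed
    (isClosed_singleton (x := x)) (isClosed_singleton (x := y))
    (Set.disjoint_singleton.2 hne)
  have h1 := congrFun hall ⟨fun z => (F z : ℂ), Complex.continuous_ofReal.comp F.continuous⟩
  have h2 : F x = F y := Complex.ofReal_injective h1
  rw [hFx rfl, hFy rfl] at h2
  simp at h2

/-- The difference of the `n`-th coordinate function and its value prescribed by the code `c`. -/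
def coordPoly (B : ℕ → ℕ) (s c n : ℕ) : UnitalPoly :=
  [(((4 ^ s, 2 * gridDigit s c n, 2 * 4 ^ s - 1), (0, 0, 0)), []),
    (bif decide (n % 2 = 0) then ((1, 0, 4 * B (n / 2) - 1), (0, 0, 0))
      else ((0, 0, 0), (0, 1, 4 * B (n / 2) - 1)), [(n / 2, false)]),
    (bif decide (n % 2 = 0) then ((1, 0, 4 * B (n / 2) - 1), (0, 0, 0))
      else ((0, 0, 0), (1, 0, 4 * B (n / 2) - 1)), [(n / 2, true)])]

/-- A polynomial whose norm is `s` minus the least squared distance of a point of the space to the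
grid point coded by `c`. -/
def gridPoly (B : ℕ → ℕ) (s c : ℕ) : UnitalPoly :=
  (((s, 0, 0), (0, 0, 0)), []) ::
    (List.range s).flatMap fun n => UnitalPoly.neg (UnitalPoly.mul (coordPoly B s c n)
      (coordPoly B s c n))

theorem computable_gridPoly {B : ℕ → ℕ} (hB : Computable B) :
    Computable fun a : ℕ × ℕ => gridPoly B a.1 a.2 := by
  unfold gridPoly coordPoly; fun_prop

theorem RatCode.val_sub_one {a b d : ℕ} (hd : 0 < d) :
    RatCode.val (a, b, d - 1) = ((a : ℚ) - b) / d := by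
  have : ((d - 1 : ℕ) : ℚ) + 1 = d := by
    rw [Nat.cast_sub hd]; simp
  simp [RatCode.val, this]

theorem eval_coordPoly_apply (v : ℕ → C(X, ℂ)) {B : ℕ → ℕ} (hB0 : ∀ n, 0 < B n) (s c n : ℕ)
    (x : X) : UnitalPoly.eval v (coordPoly B s c n) x =
      ((coordFun v B n x - gridDigit s c n / 4 ^ s : ℝ) : ℂ) := by
  have hb := hB0 (n / 2)
  have hbr : (B (n / 2) : ℝ) ≠ 0 := by exact_mod_cast hb.ne'
  have hz : RatCode.val (0, 0, 0) = 0 := by simp [RatCode.val]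
  have hc0 : ((RatCode.val (4 ^ s, 2 * gridDigit s c n, 2 * 4 ^ s - 1) : ℚ) : ℝ) =
      1 / 2 - (gridDigit s c n / 4 ^ s : ℝ) := by
    rw [RatCode.val_sub_one (by positivity)]
    push_cast
    field_simp
  have hc1 : RatCode.val (1, 0, 4 * B (n / 2) - 1) = 1 / (4 * B (n / 2)) := by
    rw [RatCode.val_sub_one (by positivity)]; push_cast; ring
  have hc2 : RatCode.val (0, 1, 4 * B (n / 2) - 1) = -(1 / (4 * B (n / 2))) := by
    rw [RatCode.val_sub_one (by positivity)]; push_cast; ring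
  generalize (gridDigit s c n / 4 ^ s : ℝ) = a at hc0 ⊢
  by_cases h : n % 2 = 0
  · simp only [coordPoly, coordFun, h, decide_true, cond_true, UnitalPoly.eval_cons,
      UnitalPoly.eval_nil, List.map_nil, List.prod_nil, List.map_cons, List.prod_cons, mul_one,
      add_zero, Letter.eval, cond_false, ContinuousMap.add_apply, ContinuousMap.smul_apply,
      ContinuousMap.one_apply, ContinuousMap.star_apply, GaussCode.val, hc0, hc1, hz, smul_eq_mul]
    apply Complex.ext
    · simp
      field_simp
      ring
    · simp
  · simp only [coordPoly, coordFun, h, decide_false, cond_true, UnitalPoly.eval_cons,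
      UnitalPoly.eval_nil, List.map_nil, List.prod_nil, List.map_cons, List.prod_cons, mul_one,
      add_zero, Letter.eval, cond_false, ContinuousMap.add_apply, ContinuousMap.smul_apply,
      ContinuousMap.one_apply, ContinuousMap.star_apply, GaussCode.val, hc0, hc1, hc2, hz,
      smul_eq_mul]
    apply Complex.ext
    · simp
      field_simp
      ring
    · simp

theorem eval_gridPoly_apply (v : ℕ → C(X, ℂ)) {B : ℕ → ℕ} (hB0 : ∀ n, 0 < B n) (s c : ℕ)
    (x : X) : UnitalPoly.eval v (gridPoly B s c) x =
      ((s - ∑ n ∈ Finset.range s, (coordFun v B n x - gridDigit s c n / 4 ^ s) ^ 2 : ℝ) : ℂ) := by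
  have hs : GaussCode.val ((s, 0, 0), (0, 0, 0)) = s := by
    apply Complex.ext <;> simp [GaussCode.val, RatCode.val]
  have hsum : (((List.range s).map fun n => UnitalPoly.eval v (UnitalPoly.neg
      (UnitalPoly.mul (coordPoly B s c n) (coordPoly B s c n)))).sum) =
      ∑ n ∈ Finset.range s, -(UnitalPoly.eval v (coordPoly B s c n) *
        UnitalPoly.eval v (coordPoly B s c n)) := by
    simp only [UnitalPoly.eval_neg, UnitalPoly.eval_mul]
    rfl
  rw [gridPoly, UnitalPoly.eval_cons, UnitalPoly.eval_flatMap, hs, hsum]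
  simp only [ContinuousMap.add_apply, ContinuousMap.smul_apply, ContinuousMap.sum_apply,
    ContinuousMap.neg_apply, ContinuousMap.mul_apply, eval_coordPoly_apply v hB0]
  push_cast
  simp [sub_eq_add_neg, sq]

/-- The decision whether `s - q < 2 / 4 ^ s`. -/
def nearLevel (s : ℕ) (q : RatCode) : Bool :=
  decide ((s * (q.2.2 + 1) + q.2.1) * 4 ^ s < 2 * (q.2.2 + 1) + q.1 * 4 ^ s)

@[fun_prop]
theorem computable_nearLevel {α : Type*} [Primcodable α] {g : α → ℕ} {q : α → RatCode}
    (hg : Computable g) (hq : Computable q) : Computable fun a => nearLevel (g a) (q a) := by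
  unfold nearLevel; fun_prop

theorem nearLevel_iff (s : ℕ) (q : RatCode) :
    nearLevel s q = true ↔ (s : ℝ) - (q.val : ℚ) < 2 * (1 / 4) ^ s := by
  simp only [nearLevel, decide_eq_true_eq]
  have hd : (0 : ℝ) < (q.2.2 : ℝ) + 1 := by positivity
  have h1 : (s : ℝ) - (q.val : ℚ) =
      (s * (q.2.2 + 1) + q.2.1 - q.1) / (q.2.2 + 1) := by
    rw [RatCode.val]; push_cast; field_simp; ring
  rw [h1, div_lt_iff₀ hd, one_div, inv_pow, ← div_eq_mul_inv, div_mul_eq_mul_div,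
    lt_div_iff₀ (by positivity), ← Nat.cast_lt (α := ℝ)]
  push_cast
  constructor <;> intro h <;> linarith

/-- An approximation of the norm of `gridPoly`. -/
def gridNorm (f : RatStarPoly × ℕ → RatCode) (e : RatStarPoly) (B : ℕ → ℕ) (s c : ℕ) : RatCode :=
  f (UnitalPoly.approx e (gridPoly B s c) (3 * s + 1), 2 * s + 1)

theorem computable_gridNorm {f : RatStarPoly × ℕ → RatCode} (hf : Computable f) (e : RatStarPoly)
    {B : ℕ → ℕ} (hB : Computable B) : Computable fun a : ℕ × ℕ => gridNorm f e B a.1 a.2 := by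
  have h1 : Computable fun a : ℕ × ℕ => UnitalPoly.approx e (gridPoly B a.1 a.2) (3 * a.1 + 1) :=
    UnitalPoly.computable_approx e (computable_gridPoly hB) (by fun_prop)
  unfold gridNorm
  exact computable_comp' hf (computable_pair h1 (by fun_prop))

theorem sum_sq_coordFun_le {v : ℕ → C(X, ℂ)} {B : ℕ → ℕ} (hB0 : ∀ n, 0 < B n)
    (hB : ∀ n, ‖v n‖ ≤ B n) (s c : ℕ) (x : X) :
    ∑ n ∈ Finset.range s, (coordFun v B n x - gridDigit s c n / 4 ^ s) ^ 2 ≤ (s : ℝ) := by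
  have h1 : ∑ n ∈ Finset.range s, (coordFun v B n x - gridDigit s c n / 4 ^ s) ^ 2 ≤
      ∑ n ∈ Finset.range s, (1 : ℝ) := by
    refine Finset.sum_le_sum fun n _ => ?_
    obtain ⟨g0, g1⟩ := coordFun_mem_Icc hB0 hB n x
    have g2 : (0 : ℝ) ≤ gridDigit s c n / 4 ^ s := by positivity
    have g3 : (gridDigit s c n / 4 ^ s : ℝ) ≤ 1 := by
      rw [div_le_one (by positivity)]
      have : gridDigit s c n < 4 ^ s + 1 := Nat.mod_lt _ (by positivity)
      exact_mod_cast Nat.lt_succ_iff.1 this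
    rw [sq_le_one_iff_abs_le_one, abs_le]
    constructor <;> linarith
  simpa using h1

theorem abs_val_sub_norm_gridPoly_lt {v : ℕ → C(X, ℂ)} {B : ℕ → ℕ} (hB0 : ∀ n, 0 < B n)
    (hB : ∀ n, ‖v n‖ ≤ B n) {f : RatStarPoly × ℕ → RatCode}
    (hf : ∀ p k, |((f (p, k)).val : ℝ) - ‖RatStarPoly.eval v p‖| < (1 / 2 : ℝ) ^ k)
    {e : RatStarPoly} (he : ‖1 - e.eval v‖ ≤ 1 / 2) (s c : ℕ) :
    |((gridNorm f e B s c).val : ℝ) - ‖UnitalPoly.eval v (gridPoly B s c)‖| < (1 / 4) ^ s := by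
  have h1 := hf (UnitalPoly.approx e (gridPoly B s c) (3 * s + 1)) (2 * s + 1)
  have h2 := (abs_norm_sub_norm_le _ _).trans
    (UnitalPoly.norm_eval_sub_approx_le v he (gridPoly B s c) (3 * s + 1))
  have h3 : ‖UnitalPoly.eval v (gridPoly B s c)‖ ≤ s := by
    refine (ContinuousMap.norm_le _ (by positivity)).2 fun x => ?_
    rw [eval_gridPoly_apply v hB0, Complex.norm_real, Real.norm_eq_abs, abs_le]
    have h0 : 0 ≤ ∑ n ∈ Finset.range s, (coordFun v B n x - gridDigit s c n / 4 ^ s) ^ 2 := by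
      positivity
    have h1 := sum_sq_coordFun_le hB0 hB s c x
    constructor <;> linarith
  have h4 : (1 / 2 : ℝ) ^ (3 * s + 1) * ‖UnitalPoly.eval v (gridPoly B s c)‖ ≤
      (1 / 2) ^ (2 * s + 1) := by
    have h5 : (s : ℝ) ≤ 2 ^ s := by exact_mod_cast Nat.lt_two_pow_self.le
    calc (1 / 2 : ℝ) ^ (3 * s + 1) * ‖UnitalPoly.eval v (gridPoly B s c)‖
        ≤ (1 / 2 : ℝ) ^ (3 * s + 1) * 2 ^ s := by gcongr; exact h3.trans h5
      _ = (1 / 2) ^ (2 * s + 1) * ((1 / 2) ^ s * 2 ^ s) := by ring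
      _ = (1 / 2) ^ (2 * s + 1) := by rw [← mul_pow]; norm_num
  have h6 : (1 / 4 : ℝ) ^ s = (1 / 2) ^ (2 * s + 1) + (1 / 2) ^ (2 * s + 1) := by
    rw [pow_succ, pow_mul]; norm_num; ring
  rw [abs_sub_comm] at h2
  refine (abs_sub_le _ _ _).trans_lt (h6 ▸ add_lt_add_of_lt_of_le h1 (h2.trans h4))

theorem ComputablyPresentable.hasComputablyCompactPresentation [T2Space X] [Nonempty X]
    (hX : ComputablyPresentable C(X, ℂ)) : HasComputablyCompactPresentation X := by
  obtain ⟨P, f, hf, hfP⟩ := hX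
  obtain ⟨e, he⟩ : ∃ e : RatStarPoly, ‖1 - e.eval P.vec‖ ≤ 1 / 2 := by
    obtain ⟨e, he⟩ := Metric.denseRange_iff.1 P.denseRange_eval 1 (1 / 2) (by norm_num)
    exact ⟨e, by rw [← dist_eq_norm]; exact he.le⟩
  let gen : ℕ → RatStarPoly := fun n => [(((1, 0, 0), (0, 0, 0)), (n, false), [])]
  let B : ℕ → ℕ := fun n => (f (gen n, 0)).1 + 1
  have hBc : Computable B := by fun_prop
  have hB0 (n : ℕ) : 0 < B n := by simp [B]
  have hB (n : ℕ) : ‖P.vec n‖ ≤ B n := by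
    have hgen : RatStarPoly.eval P.vec (gen n) = P.vec n := by
      have hc : GaussCode.val ((1, 0, 0), (0, 0, 0)) = 1 := by
        apply Complex.ext <;> simp [GaussCode.val, RatCode.val]
      simp [gen, RatStarPoly.eval, RatMonomial.eval, Letter.eval, hc]
    have h1 := (abs_lt.1 (hfP (gen n) 0)).1
    rw [hgen, pow_zero] at h1
    have h2 : ((f (gen n, 0)).val : ℝ) ≤ (f (gen n, 0)).1 := by
      rw [RatCode.val]; push_cast
      rw [div_le_iff₀ (by positivity)]
      nlinarith [Nat.cast_nonneg (α := ℝ) (f (gen n, 0)).1,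
        Nat.cast_nonneg (α := ℝ) (f (gen n, 0)).2.1, Nat.cast_nonneg (α := ℝ) (f (gen n, 0)).2.2,
        mul_nonneg (Nat.cast_nonneg (α := ℝ) (f (gen n, 0)).1)
          (Nat.cast_nonneg (α := ℝ) (f (gen n, 0)).2.2)]
    simp only [B]; push_cast
    linarith
  refine hasComputablyCompactPresentation_of_test (h := coordFun P.vec B)
    (continuous_coordFun P.vec B) (fun n x => (coordFun_mem_Icc hB0 hB n x).1)
    (fun n x => (coordFun_mem_Icc hB0 hB n x).2) (fun x y => eq_of_coordFun_eq P hB0)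
    (test := fun a => nearLevel a.1 (gridNorm f e B a.1 a.2))
    (computable_nearLevel (by fun_prop) (computable_gridNorm hf e hBc)) (fun s c hsc => ?_) (fun s c x hx => ?_)
  · rw [nearLevel_iff] at hsc
    have h1 := (abs_lt.1 (abs_val_sub_norm_gridPoly_lt hB0 hB hfP he s c)).2
    by_contra! hcon
    have h2 : ‖UnitalPoly.eval P.vec (gridPoly B s c)‖ ≤ s - 3 * (1 / 4) ^ s := by
      refine (ContinuousMap.norm_le_of_nonempty _).2 fun x => ?_
      obtain ⟨i, hi, hix⟩ := hcon x
      have g1 := sum_sq_coordFun_le hB0 hB s c x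
      have g2 := Finset.single_le_sum (s := Finset.range s)
        (f := fun n => (coordFun P.vec B n x - gridDigit s c n / 4 ^ s) ^ 2)
        (fun n _ => sq_nonneg _) (Finset.mem_range.2 hi)
      have g3 : 4 * (1 / 4 : ℝ) ^ s ≤ (coordFun P.vec B i x - gridDigit s c i / 4 ^ s) ^ 2 := by
        have : 4 * (1 / 4 : ℝ) ^ s = (2 * (1 / 2) ^ s) ^ 2 := by
          rw [mul_pow, ← pow_mul, mul_comm s 2, pow_mul]; norm_num
        rw [this, ← sq_abs (coordFun P.vec B i x - _)]
        gcongr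
      have g4 : (1 / 4 : ℝ) ^ s ≤ (1 / 4) ^ 1 :=
        pow_le_pow_of_le_one (by norm_num) (by norm_num) (by omega)
      have g5 : (1 : ℝ) ≤ s := by exact_mod_cast (by omega : 1 ≤ s)
      have g6 : (0 : ℝ) < (1 / 4) ^ s := by positivity
      rw [eval_gridPoly_apply _ hB0, Complex.norm_real, Real.norm_eq_abs, abs_le]
      constructor <;> linarith
    linarith
  · rw [nearLevel_iff]
    have h1 := (abs_lt.1 (abs_val_sub_norm_gridPoly_lt hB0 hB hfP he s c)).1
    have h2 := (UnitalPoly.eval P.vec (gridPoly B s c)).norm_coe_le_norm x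
    rw [eval_gridPoly_apply _ hB0, Complex.norm_real, Real.norm_eq_abs] at h2
    have h3 := (le_abs_self _).trans h2
    have h4 : ∑ n ∈ Finset.range s, (coordFun P.vec B n x - gridDigit s c n / 4 ^ s) ^ 2 ≤
        ∑ n ∈ Finset.range s, (1 / 4 ^ s : ℝ) ^ 2 :=
      Finset.sum_le_sum fun n hn => sq_le_sq' (by linarith [(abs_le.1 (hx n (Finset.mem_range.1 hn))).1])
        (abs_le.1 (hx n (Finset.mem_range.1 hn))).2
    rw [Finset.sum_const, Finset.card_range, nsmul_eq_mul] at h4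
    have h5 : (s : ℝ) * (1 / 4 ^ s) ^ 2 ≤ (1 / 4) ^ s := by
      have h6 : (s : ℝ) ≤ 4 ^ s := by exact_mod_cast (Nat.lt_pow_self (by norm_num)).le
      calc (s : ℝ) * (1 / 4 ^ s) ^ 2 ≤ 4 ^ s * (1 / 4 ^ s) ^ 2 := by gcongr
        _ = (1 / 4) ^ s := by rw [div_pow 1 4, one_pow]; field_simp
    linarith

end SpectrumTest

end ComputableGelfand

theorem theorem1p1
    (X : Type*) [TopologicalSpace X] [CompactSpace X] [TopologicalSpace.MetrizableSpace X]
    [Nonempty X] (A : Type*) [CommCStarAlgebra A] [Nontrivial A] :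
    (ComputableGelfand.ComputablyPresentable C(X, ℂ) →
      ComputableGelfand.HasComputablyCompactPresentation X) ∧
    (ComputableGelfand.HasComputablyCompactPresentation X →
      ComputableGelfand.ComputablyPresentable C(X, ℂ)) ∧
    (ComputableGelfand.ComputablyPresentable A ↔
      ComputableGelfand.HasComputablyCompactPresentation
        (WeakDual.characterSpace ℂ A)) := by
  refine ⟨fun h => h.hasComputablyCompactPresentation, fun h => h.computablyPresentable,
    fun h => ?_, fun h => ?_⟩
  · exact (h.of_starAlgEquiv (gelfandStarTransform A)).hasComputablyCompactPresentation
  · exact h.computablyPresentable.of_starAlgEquiv (gelfandStarTransform A).symm
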